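/- **Theorem (Soundness of concurrent separation logic).** *Let $\pi$ be a derivation tree of $\Gamma\vdash\{P\}\,C\,\{Q\}$. Then for every execution trace $t\in[\![C]\!]$ there is a winning strategy in the separation game $\mathbf{SGame}(t)$ determined by $\Gamma\vdash\{P\}\,C\,\{Q\}$ and $t$.* The notions are as follows. **States.** Fix a set $\mathbf{Var}$ of variables, $\mathbf{Val}=\mathbb Z$, $\mathbf{Loc}=\mathbb N\subseteq\mathbf{Val}$, a finite set $\mathbf{LockName}$ of resources, and a permission monoid: a set $\mathbf{Perm}$ with a partial commutative associative cancellative product such that $p\cdot q\neq p$ for all $p,q$ (the unit is adjoined and is not an element of $\mathbf{Perm}$), and an element $\top$ such that $\top\cdot p$ is undefined for all $p\in\mathbf{Perm}$. A memory state $\mu=(s,h)$ is a pair of finite partial maps $\mathbf{Var}\rightharpoonup\mathbf{Val}$, $\mathbf{Loc}\rightharpoonup\mathbf{Val}$; a machine state is $\mathfrak s=(\mu,L)$ with $L\subseteq\mathbf{LockName}$ the set of locked resources. A logical state is a pair of finite partial maps $\mathbf{Var}\rightharpoonup\mathbf{Val}\times\mathbf{Perm}$, $\mathbf{Loc}\rightharpoonup\mathbf{Val}\times\mathbf{Perm}$;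 the partial product $\sigma*\sigma'$ is the union, where at a common point the values must agree and the permissions are multiplied (it is undefined if this is impossible). $U$ forgets permissions. **Instructions** are $x:=E$, $x:=[E]$, $[E]:=E'$, $\mathsf{nop}$, $x:=\mathsf{alloc}(E)$, $\mathsf{dispose}(E)$, $P(r)$, $V(r)$. A machine step $\mathfrak s\xrightarrow{m}\mathfrak s'$ is either successful, with the usual effect ($P(r)$ needs $r\notin L$ and locks $r$, $V(r)$ needs $r\in L$ and unlocks $r$), or an error with $\mathfrak s'=\mathfrak s$; errors occur when an expression contains an unallocated variable, or when the address in $[E]$ or $\mathsf{dispose}(E)$ is not an allocated location. $P(r)$ and $V(r)$ never err. **Traces.** A trace of length $p$ is an alternating sequence $\mathfrak s_1\xrightarrow{env}\mathfrak s_2\xrightarrow{m_1}\mathfrak s_3\xrightarrow{env}\cdots\xrightarrow{m_p}\mathfrak s_{2p+1}\xrightarrow{env}\mathfrak s_{2p+2}$ of arbitrary Environment transitions and of machine steps. A prefix of a trace is again a trace, i.e. ends with an Environment transition. A transition system is a set of traces closed under prefix, with a subset of returning traces; below, sets of traces are always completed by their prefixes (a prefix added in this way does not return). $[\![m]\!]$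 consists of the traces of length $1$ labelled $m$; those with a successful step return. $T;T'$ consists of $T$ and of the concatenations $t\cdot t'$ of a returning $t\in T$ and of $t'\in T'$ such that the last state of $t$ is the first of $t'$ (the two Environment transitions in the middle are merged); $t\cdot t'$ returns if $t'$ returns. $T\parallel T'$ consists of the traces whose sequence of Code transitions is a shuffle of those of some $t\in T$ and $t'\in T'$ with the same first and the same last state; it returns if, for some such choice, $t$ and $t'$ return. $\mathsf{when}_{B}(T)$ consists of the traces of $T$ in which $B$ is true in $\mathfrak s_2$ (no condition if $p=0$), and $\mathsf{when}_{\neg B}(T)$ is the same with false. $\mathsf{abort}_B$ consists of the non-returning traces of length $1$ in which $B$ contains a variable unallocated in $\mathfrak s_2$ and the Code makes an erroneous step reading such a variable. $\mathsf{hide}_r(T)$ is obtained from the traces of $T$ in which $r$ is private to the Code ($r$ is unlocked in $\mathfrak s_1$ and no Environment transition changes whether $r$ is locked) by removing $r$ from all lock sets and replacing $P(r),V(r)$ by $\mathsf{nop}$; returning traces are mapped to returning ones. **Semantics.** Basic commands denote their instruction and $\mathsf{skip}$ denotes $[\![\mathsf{nop}]\!]$. Further, $[\![C;C']\!]=[\![C]\!];[\![C']\!]$,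 $[\![C\parallel C']\!]=[\![C]\!]\parallel[\![C']\!]$, $[\![\mathsf{resource}\ r\ \mathsf{do}\ C]\!]=\mathsf{hide}_r[\![C]\!]$, $[\![\mathsf{with}\ r\ \mathsf{when}\ B\ \mathsf{do}\ C]\!]=\mathsf{when}_B([\![P(r)]\!];[\![C]\!];[\![V(r)]\!])\cup\mathsf{abort}_B$, $[\![\mathsf{if}\ B\ \mathsf{then}\ C_1\ \mathsf{else}\ C_2]\!]=\mathsf{when}_B([\![\mathsf{nop}]\!]);[\![C_1]\!]\,\cup\,\mathsf{when}_{\neg B}([\![\mathsf{nop}]\!]);[\![C_2]\!]\,\cup\,\mathsf{abort}_B$, and $[\![\mathsf{while}\ B\ \mathsf{do}\ C]\!]=\bigcup_n F^n(\emptyset)$ with $F(T)=\mathsf{when}_B([\![\mathsf{nop}]\!]);[\![C]\!];T\,\cup\,\mathsf{when}_{\neg B}([\![\mathsf{nop}]\!])\,\cup\,\mathsf{abort}_B$. **Logic.** Predicates are sets of logical states. $\sigma\vDash\mathrm{own}_p(x)$ iff $\sigma(x)=(v,p)$ for some $v$; $\sigma\vDash E=E'$ iff $E$ and $E'$ have all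 their variables in the stack of $\sigma$ and have the same value; $\sigma\vDash E\mapsto^pE'$ iff the heap of $\sigma$ is the single cell $E$ with content $(E',p)$, the variables of $E,E'$ being in the stack; $\mapsto$ is $\mapsto^\top$, and $E\mapsto-$ is $\exists v.\,E\mapsto v$; $\mathrm{def}(E)$, $\mathrm{def}(B)$ say that the variables of $E$, $B$ are in the stack; $P*Q$ is the set of the products $\sigma_1*\sigma_2$ with $\sigma_1\vDash P$, $\sigma_2\vDash Q$. $P$ is precise if every $\sigma$ has at most one $\sigma'\vDash P$ with $\sigma=\sigma'*\sigma''$ for some $\sigma''$. A context $\Gamma$ is a partial function from resources to predicates, precise if all its values are. Derivation trees are built from the rules (in $\textsc{Res}$ and $\textsc{With}$, $r\notin\mathrm{dom}\,\Gamma$): - $\textsc{Aff}$: $\Gamma\vdash\{\mathrm{own}_\top(x)\wedge X=E\}\ x:=E\ \{\mathrm{own}_\top(x)\wedge x=X\}$ for every value $X$; - $\textsc{Store}$: $\Gamma\vdash\{E\mapsto-\,\wedge\,\mathrm{def}(E')\}\ [E]:=E'\ \{E\mapsto E'\}$; - $\textsc{Load}$: $\Gamma\vdash\{E\mapsto^pv*\mathrm{own}_\top(x)\}\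 x:=[E]\ \{E\mapsto^pv*(\mathrm{own}_\top(x)\wedge x=v)\}$ if $x\notin\mathrm{fv}(E)$; - $\textsc{Seq}$: from $\Gamma\vdash\{P\}C\{Q\}$ and $\Gamma\vdash\{Q\}C'\{R\}$ infer $\Gamma\vdash\{P\}C;C'\{R\}$; - $\textsc{If}$: from $P\Rightarrow\mathrm{def}(B)$, $\Gamma\vdash\{P\wedge B\}C_1\{Q\}$ and $\Gamma\vdash\{P\wedge\neg B\}C_2\{Q\}$ infer $\Gamma\vdash\{P\}\,\mathsf{if}\ B\ \mathsf{then}\ C_1\ \mathsf{else}\ C_2\,\{Q\}$; - $\textsc{Conj}$: from $\Gamma$ precise, $\Gamma\vdash\{P_1\}C\{Q_1\}$ and $\Gamma\vdash\{P_2\}C\{Q_2\}$ infer $\Gamma\vdash\{P_1\wedge P_2\}C\{Q_1\wedge Q_2\}$; - $\textsc{Res}$: from $\Gamma,r:J\vdash\{P\}C\{Q\}$ infer $\Gamma\vdash\{P*J\}\,\mathsf{resource}\ r\ \mathsf{do}\ C\,\{Q*J\}$; - $\textsc{With}$: from $P\Rightarrow\mathrm{def}(B)$ and $\Gamma\vdash\{(P*J)\wedge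 B\}C\{Q*J\}$ infer $\Gamma,r:J\vdash\{P\}\,\mathsf{with}\ r\ \mathsf{when}\ B\ \mathsf{do}\ C\,\{Q\}$; - $\textsc{Par}$: from $\Gamma\vdash\{P_i\}C_i\{Q_i\}$, $i=1,2$, infer $\Gamma\vdash\{P_1*P_2\}C_1\parallel C_2\{Q_1*Q_2\}$; - $\textsc{Frame}$: from $\Gamma\vdash\{P\}C\{Q\}$ infer $\Gamma\vdash\{P*R\}C\{Q*R\}$; - $\textsc{Conseq}$: from $P'\Rightarrow P$, $\Gamma\vdash\{P\}C\{Q\}$ and $Q\Rightarrow Q'$ infer $\Gamma\vdash\{P'\}C\{Q'\}$. **Game.** A separated state is a triple $(\sigma_C,\boldsymbol\sigma,\sigma_F)$ with $\sigma_C,\sigma_F$ logical states and $\boldsymbol\sigma(r)$, for each resource $r$, a logical state ($r$ is available), or $C$, or $F$ ($r$ is locked by Code or Frame), such that the product of $\sigma_C$, of all available $\boldsymbol\sigma(r)$ and of $\sigma_F$ is defined. It combines into the machine state $(\mu,L)$ with $\mu$ the image of that product under $U$ and $L$ the set of the resources $r$ with $\boldsymbol\sigma(r)\in\{C,F\}$.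 Adam's moves $(\sigma_C,\boldsymbol\sigma,\sigma_F)\xrightarrow{env}(\sigma_C,\boldsymbol\sigma',\sigma_F')$ keep the set of resources locked by $C$. Eve's moves $(\sigma_C,\boldsymbol\sigma,\sigma_F)\xrightarrow{m}(\sigma'_C,\boldsymbol\sigma',\sigma_F)$ combine into a successful machine step labelled $m$, and satisfy $\boldsymbol\sigma(r)=\boldsymbol\sigma'(r)$ for all $r$ not acquired or released by $m$; a resource acquired by $m$ goes from available to $C$, and a resource released by $m$ from $C$ to available. The plays of $\mathbf{SGame}(t)$ are the finite paths of such moves, possibly empty, which combine into an initial segment of the path $t$. A strategy is a prefix-closed set of plays. Let $t$ have length $p$. A play is winning if in each of its states every available resource $r\in\mathrm{dom}\,\Gamma$ has $\boldsymbol\sigma(r)\vDash\Gamma(r)$, its first state has $\sigma_C\vDash P$, and, when $t$ is a returning trace of $[\![C]\!]$, its states number $2p+1$ and $2p+2$ (if reached) have $\sigma_C\vDash Q$. A strategy is winning if it contains only winning plays, contains every empty winning play, and for every play $\alpha$ in it and every move $a$ of Adam such that $\alpha\cdot a$ is a winning play of $\mathbf{SGame}(t)$, it contains $\alpha\cdot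 a$ and, unless $a$ is the last transition of $t$, also $\alpha\cdot a\cdot e$ for some move $e$ of Eve. -/

import Mathlib

namespace CSL

universe u v w

/-! ## Finite partial maps -/

/-- Partial functions from `α` to `β` with finite domain (`none` means undefined). -/
structure FinPMap (α : Type u) (β : Type v) where
  toFun : α → Option β
  finite_dom : {a | toFun a ≠ none}.Finite

namespace FinPMap

variable {α : Type u} {β : Type v} {γ : Type w}

instance : FunLike (FinPMap α β) α (Option β) where
  coe := toFun
  coe_injective := by
    rintro ⟨f, _⟩ ⟨g, _⟩ h
    cases h
    rfl

theorem finite (f : FinPMap α β) : {a | f a ≠ none}.Finite := f.finite_dom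

/-- The map with empty domain. -/
def empty : FinPMap α β := ⟨fun _ => none, by simp⟩

open Classical in
/-- The map obtained from `f` by setting the value at `a` to `b` (`b = none` removes `a` from the
domain). -/
noncomputable def put (f : FinPMap α β) (a : α) (b : Option β) : FinPMap α β where
  toFun := Function.update f a b
  finite_dom := by
    refine (f.finite.insert a).subset ?_
    intro x hx
    by_cases h : x = a
    · exact Or.inl h
    · refine Or.inr ?_
      simpa [Function.update_of_ne h] using hx

/-- Post-composition with a total function. -/
def map (g : β → γ) (f : FinPMap α β) : FinPMap α γ where
  toFun := fun a => (f a).map g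
  finite_dom := f.finite.subset (by intro x hx h; simp_all)

end FinPMap

/-! ## Expressions -/

/-- Memory states: a stack (finite partial map from variables to values) and a heap (finite partial
map from locations to values), presented as one finite partial map on the disjoint union of
variables and locations. Values are integers, locations are natural numbers. -/
abbrev State (Var : Type u) := FinPMap (Var ⊕ ℕ) ℤ

/-- Arithmetic expressions. -/
inductive AExp (Var : Type u) where
  | const (n : ℤ)
  | var (x : Var)
  | plus (E F : AExp Var)
  | times (E F : AExp Var)

/-- Boolean expressions. -/
inductive BExp (Var : Type u) where
  | true
  | false
  | and (B B' : BExp Var)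
  | or (B B' : BExp Var)
  | eq (E F : AExp Var)

section Expressions

variable {Var : Type u}

/-- Value of an expression; undefined when a variable of the expression is not allocated. -/
def AExp.eval (μ : State Var) : AExp Var → Option ℤ
  | .const n => some n
  | .var x => μ (Sum.inl x)
  | .plus E F => (E.eval μ).bind fun a => (F.eval μ).map fun b => a + b
  | .times E F => (E.eval μ).bind fun a => (F.eval μ).map fun b => a * b

/-- Variables of an arithmetic expression. -/
def AExp.fv : AExp Var → Set Var
  | .const _ => ∅
  | .var x => {x}
  | .plus E F => E.fv ∪ F.fv
  | .times E F => E.fv ∪ F.fv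

/-- Value of a boolean expression; `none` means that the evaluation aborts, which happens exactly
when a variable of the expression is not allocated. -/
def BExp.eval (μ : State Var) : BExp Var → Option Bool
  | .true => some Bool.true
  | .false => some Bool.false
  | .and B B' => (B.eval μ).bind fun a => (B'.eval μ).map fun b => a && b
  | .or B B' => (B.eval μ).bind fun a => (B'.eval μ).map fun b => a || b
  | .eq E F => (E.eval μ).bind fun a => (F.eval μ).map fun b => decide (a = b)

/-- Variables of a boolean expression. -/
def BExp.fv : BExp Var → Set Var
  | .true => ∅
  | .false => ∅
  | .and B B' => B.fv ∪ B'.fv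
  | .or B B' => B.fv ∪ B'.fv
  | .eq E F => E.fv ∪ F.fv

end Expressions

/-! ## Machine states and instructions -/

/-- Machine states: a memory state together with the set of locked resources. -/
@[ext]
structure MState (Var : Type u) (Lock : Type v) where
  mem : State Var
  locks : Set Lock

/-- Machine instructions. -/
inductive Instr (Var : Type u) (Lock : Type v) where
  | assign (x : Var) (E : AExp Var)
  | load (x : Var) (E : AExp Var)
  | store (E E' : AExp Var)
  | nop
  | alloc (x : Var) (E : AExp Var)
  | dispose (E : AExp Var)
  | acquire (r : Lock)
  | release (r : Lock)

section Machine

variable {Var : Type u} {Lock : Type v}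

/-- The locks taken by an instruction. -/
def Instr.locksTaken : Instr Var Lock → Set Lock
  | .acquire r => {r}
  | _ => ∅

/-- The locks released by an instruction. -/
def Instr.locksReleased : Instr Var Lock → Set Lock
  | .release r => {r}
  | _ => ∅

/-- `E` evaluates in `μ` to the allocated location `l`. -/
def PointsAt (μ : State Var) (E : AExp Var) (l : ℕ) : Prop :=
  E.eval μ = some (l : ℤ) ∧ μ (Sum.inr l) ≠ none

/-- `Returns s m s'`: in `s`, the instruction `m` can be executed successfully and lead to `s'`. -/
inductive Returns : MState Var Lock → Instr Var Lock → MState Var Lock → Prop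
  | assign {μ : State Var} {L : Set Lock} {x : Var} {E : AExp Var} {n : ℤ} :
      E.eval μ = some n →
      Returns ⟨μ, L⟩ (.assign x E) ⟨μ.put (Sum.inl x) (some n), L⟩
  | load {μ : State Var} {L : Set Lock} {x : Var} {E : AExp Var} {l : ℕ} {n : ℤ} :
      E.eval μ = some (l : ℤ) → μ (Sum.inr l) = some n →
      Returns ⟨μ, L⟩ (.load x E) ⟨μ.put (Sum.inl x) (some n), L⟩
  | store {μ : State Var} {L : Set Lock} {E E' : AExp Var} {l : ℕ} {n : ℤ} :
      PointsAt μ E l → E'.eval μ = some n →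
      Returns ⟨μ, L⟩ (.store E E') ⟨μ.put (Sum.inr l) (some n), L⟩
  | nop {μ : State Var} {L : Set Lock} :
      Returns ⟨μ, L⟩ .nop ⟨μ, L⟩
  | alloc {μ : State Var} {L : Set Lock} {x : Var} {E : AExp Var} {l : ℕ} {n : ℤ} :
      E.eval μ = some n → μ (Sum.inr l) = none →
      Returns ⟨μ, L⟩ (.alloc x E) ⟨(μ.put (Sum.inr l) (some n)).put (Sum.inl x) (some (l : ℤ)), L⟩
  | dispose {μ : State Var} {L : Set Lock} {E : AExp Var} {l : ℕ} :
      PointsAt μ E l →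
      Returns ⟨μ, L⟩ (.dispose E) ⟨μ.put (Sum.inr l) none, L⟩
  | acquire {μ : State Var} {L : Set Lock} {r : Lock} :
      r ∉ L → Returns ⟨μ, L⟩ (.acquire r) ⟨μ, insert r L⟩
  | release {μ : State Var} {L : Set Lock} {r : Lock} :
      r ∉ L → Returns ⟨μ, insert r L⟩ (.release r) ⟨μ, L⟩

/-- `Errs s m s'`: in `s`, executing the instruction `m` produces a runtime error, because an
expression cannot be evaluated or a location is not allocated; the state is left unchanged. -/
inductive Errs : MState Var Lock → Instr Var Lock → MState Var Lock → Prop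
  | assign {s : MState Var Lock} {x : Var} {E : AExp Var} :
      E.eval s.mem = none → Errs s (.assign x E) s
  | load {s : MState Var Lock} {x : Var} {E : AExp Var} :
      (¬ ∃ l, PointsAt s.mem E l) → Errs s (.load x E) s
  | store_addr {s : MState Var Lock} {E E' : AExp Var} :
      (¬ ∃ l, PointsAt s.mem E l) → Errs s (.store E E') s
  | store_val {s : MState Var Lock} {E E' : AExp Var} :
      E'.eval s.mem = none → Errs s (.store E E') s
  | alloc {s : MState Var Lock} {x : Var} {E : AExp Var} :
      E.eval s.mem = none → Errs s (.alloc x E) s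
  | dispose {s : MState Var Lock} {E : AExp Var} :
      (¬ ∃ l, PointsAt s.mem E l) → Errs s (.dispose E) s

/-- Machine steps, successful or not. -/
def MStep (s : MState Var Lock) (m : Instr Var Lock) (s' : MState Var Lock) : Prop :=
  Returns s m s' ∨ Errs s m s'

/-- Removing the resource `r` from the lock state. -/
def MState.hide (r : Lock) (s : MState Var Lock) : MState Var Lock := ⟨s.mem, s.locks \ {r}⟩

open Classical in
/-- Replacing the operations on the resource `r` by `nop`. -/
noncomputable def Instr.hide (r : Lock) : Instr Var Lock → Instr Var Lock
  | .acquire r' => if r' = r then .nop else .acquire r'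
  | .release r' => if r' = r then .nop else .release r'
  | m => m

theorem MStep.hide (r : Lock) {s s' : MState Var Lock} {m : Instr Var Lock} (h : MStep s m s') :
    MStep (s.hide r) (m.hide r) (s'.hide r) := by
  rcases h with h | h
  · left
    cases h with
    | assign h => exact .assign h
    | load h h' => exact .load h h'
    | store h h' => exact .store h h'
    | nop => exact .nop
    | alloc h h' => exact .alloc h h'
    | dispose h => exact .dispose h
    | @acquire μ L r' h =>
      by_cases hr : r' = r
      · subst hr
        simpa [MState.hide, Instr.hide] using Returns.nop
      · have : insert r' L \ {r} = insert r' (L \ {r}) :=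
          Set.insert_sdiff_of_notMem _ (by simpa using hr)
        simp only [MState.hide, Instr.hide, hr, if_false, this]
        exact .acquire fun h' => h h'.1
    | @release μ L r' h =>
      by_cases hr : r' = r
      · subst hr
        simpa [MState.hide, Instr.hide] using Returns.nop
      · have : insert r' L \ {r} = insert r' (L \ {r}) :=
          Set.insert_sdiff_of_notMem _ (by simpa using hr)
        simp only [MState.hide, Instr.hide, hr, if_false, this]
        exact .release fun h' => h h'.1
  · right
    cases h with
    | assign h => exact .assign h
    | load h => exact .load h
    | store_addr h => exact .store_addr h
    | store_val h => exact .store_val h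
    | alloc h => exact .alloc h
    | dispose h => exact .dispose h

end Machine

/-! ## Execution traces -/

/-- A Code transition: a machine step. -/
@[ext]
structure CodeStep (Var : Type u) (Lock : Type v) where
  pre : MState Var Lock
  instr : Instr Var Lock
  post : MState Var Lock
  isStep : MStep pre instr post

/-- An execution trace
`source --env--> pre₁ --m₁--> post₁ --env--> pre₂ --m₂--> ⋯ --mₚ--> postₚ --env--> target`
given by its initial state, its final state and the sequence of its Code transitions; the
Environment transitions are arbitrary. -/
@[ext]
structure Trace (Var : Type u) (Lock : Type v) where
  source : MState Var Lock
  steps : List (CodeStep Var Lock)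
  target : MState Var Lock

/-- `Shuffle l₁ l₂ l`: the list `l` is an interleaving of `l₁` and `l₂`. -/
inductive Shuffle {α : Type u} : List α → List α → List α → Prop
  | nil : Shuffle [] [] []
  | left {a : α} {l₁ l₂ l : List α} : Shuffle l₁ l₂ l → Shuffle (a :: l₁) l₂ (a :: l)
  | right {a : α} {l₁ l₂ l : List α} : Shuffle l₁ l₂ l → Shuffle l₁ (a :: l₂) (a :: l)

section Traces

variable {Var : Type u} {Lock : Type v}

/-- The number of Code transitions. -/
def Trace.length (t : Trace Var Lock) : ℕ := t.steps.length

/-- The state from which the first of the given Code transitions starts, or `s` if there is none. -/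
def nextState (l : List (CodeStep Var Lock)) (s : MState Var Lock) : MState Var Lock :=
  match l with
  | [] => s
  | st :: _ => st.pre

/-- `t` is an initial segment of `t'`: it consists of the first Code transitions of `t'` and ends
with the Environment transition of `t'` that follows them. -/
def Trace.Initial (t t' : Trace Var Lock) : Prop :=
  t.source = t'.source ∧
    ∃ rest, t'.steps = t.steps ++ rest ∧ t.target = nextState rest t'.target

theorem Trace.Initial.refl (t : Trace Var Lock) : t.Initial t := ⟨rfl, [], by simp, rfl⟩

theorem Trace.Initial.trans {t₁ t₂ t₃ : Trace Var Lock} (h : t₁.Initial t₂) (h' : t₂.Initial t₃) :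
    t₁.Initial t₃ := by
  obtain ⟨e, r, hs, ht⟩ := h
  obtain ⟨e', r', hs', ht'⟩ := h'
  refine ⟨e.trans e', r ++ r', by rw [hs', hs, List.append_assoc], ?_⟩
  cases r with
  | nil => simpa [nextState, ht'] using ht
  | cons a r => simpa [nextState] using ht

/-- Sequential composition of traces (used when `t.target = t'.source`): the two Environment
transitions in the middle are merged. -/
def Trace.comp (t t' : Trace Var Lock) : Trace Var Lock :=
  ⟨t.source, t.steps ++ t'.steps, t'.target⟩

/-- `t ∈ t₁ ∥ t₂`: the three traces are coinitial and cofinal, and the Code transitions of `t` are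
a shuffle of those of `t₁` and `t₂`. -/
def Trace.InParallel (t₁ t₂ t : Trace Var Lock) : Prop :=
  t₁.source = t.source ∧ t₂.source = t.source ∧
  t₁.target = t.target ∧ t₂.target = t.target ∧
  Shuffle t₁.steps t₂.steps t.steps

/-- Hiding a resource in a Code transition. -/
noncomputable def CodeStep.hide (r : Lock) (st : CodeStep Var Lock) : CodeStep Var Lock :=
  ⟨st.pre.hide r, st.instr.hide r, st.post.hide r, st.isStep.hide r⟩

/-- Hiding a resource in a trace. -/
noncomputable def Trace.hide (r : Lock) (t : Trace Var Lock) : Trace Var Lock :=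
  ⟨t.source.hide r, t.steps.map (CodeStep.hide r), t.target.hide r⟩

/-- Starting from the state `s`, no Environment transition changes the status of `r`. -/
def EnvKeeps (r : Lock) (s : MState Var Lock) (l : List (CodeStep Var Lock))
    (target : MState Var Lock) : Prop :=
  match l with
  | [] => r ∈ s.locks ↔ r ∈ target.locks
  | st :: l => (r ∈ s.locks ↔ r ∈ st.pre.locks) ∧ EnvKeeps r st.post l target

/-- The resource `r` is private to the Code in `t`: it is initially available, and it is never
locked or unlocked by the Environment. -/
def Trace.Private (r : Lock) (t : Trace Var Lock) : Prop :=
  r ∉ t.source.locks ∧ EnvKeeps r t.source t.steps t.target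

end Traces

/-! ## Transition systems -/

/-- Transition systems: a set of traces closed under initial segments, together with the subset of
those that return. -/
structure TransSys (Var : Type u) (Lock : Type v) where
  traces : Set (Trace Var Lock)
  ret : Set (Trace Var Lock)
  ret_subset : ret ⊆ traces
  closed : ∀ t t', t'.Initial t → t ∈ traces → t' ∈ traces

namespace TransSys

variable {Var : Type u} {Lock : Type v}

/-- The transition system with the given returning traces, whose traces are the initial segments of
the given traces. -/
def generate (T R : Set (Trace Var Lock)) : TransSys Var Lock where
  traces := {t | ∃ t' ∈ T ∪ R, t.Initial t'}
  ret := R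
  ret_subset := fun t ht => ⟨t, Or.inr ht, Trace.Initial.refl t⟩
  closed := fun _ _ h ⟨t', ht', h'⟩ => ⟨t', ht', h.trans h'⟩

/-- The empty transition system. -/
def empty : TransSys Var Lock := generate ∅ ∅

def union (T T' : TransSys Var Lock) : TransSys Var Lock :=
  generate (T.traces ∪ T'.traces) (T.ret ∪ T'.ret)

def iUnion (T : ℕ → TransSys Var Lock) : TransSys Var Lock :=
  generate (⋃ n, (T n).traces) (⋃ n, (T n).ret)

/-- The transition system of an instruction. -/
def ofInstr (m : Instr Var Lock) : TransSys Var Lock :=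
  generate {t | ∃ st : CodeStep Var Lock, t.steps = [st] ∧ st.instr = m}
    {t | ∃ st : CodeStep Var Lock, t.steps = [st] ∧ st.instr = m ∧
      Returns st.pre st.instr st.post}

def seq (T T' : TransSys Var Lock) : TransSys Var Lock :=
  generate
    (T.traces ∪ {t | ∃ t₁ ∈ T.ret, ∃ t₂ ∈ T'.traces, t₁.target = t₂.source ∧ t = t₁.comp t₂})
    {t | ∃ t₁ ∈ T.ret, ∃ t₂ ∈ T'.ret, t₁.target = t₂.source ∧ t = t₁.comp t₂}

def par (T T' : TransSys Var Lock) : TransSys Var Lock :=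
  generate {t | ∃ t₁ ∈ T.traces, ∃ t₂ ∈ T'.traces, t₁.InParallel t₂ t}
    {t | ∃ t₁ ∈ T.ret, ∃ t₂ ∈ T'.ret, t₁.InParallel t₂ t}

/-- Hiding the resource `r`, which is private to the Code. -/
def hide (r : Lock) (T : TransSys Var Lock) : TransSys Var Lock :=
  generate {t | ∃ t' ∈ T.traces, t'.Private r ∧ t = t'.hide r}
    {t | ∃ t' ∈ T.ret, t'.Private r ∧ t = t'.hide r}

def inside (r : Lock) (T : TransSys Var Lock) : TransSys Var Lock :=
  ((ofInstr (.acquire r)).seq T).seq (ofInstr (.release r))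

/-- The traces in which `B` has the boolean value `b` in the first state played by the Code. The
condition is void for traces without Code transitions. -/
def when (B : BExp Var) (b : Bool) (T : TransSys Var Lock) : TransSys Var Lock :=
  generate {t ∈ T.traces | ∀ st ∈ t.steps.head?, B.eval st.pre.mem = some b}
    {t ∈ T.ret | ∀ st ∈ t.steps.head?, B.eval st.pre.mem = some b}

/-- The traces in which the evaluation of `B` aborts: the Code makes an erroneous step while reading
a variable of `B` which is not allocated. None of them returns. -/
def whenAbort (B : BExp Var) : TransSys Var Lock :=
  generate
    {t | ∃ st : CodeStep Var Lock, ∃ x ∈ B.fv, t.steps = [st] ∧ B.eval st.pre.mem = none ∧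
      st.instr = .assign x (.var x) ∧ Errs st.pre st.instr st.post}
    ∅

end TransSys

/-! ## The concurrent language -/

/-- Commands. -/
inductive Cmd (Var : Type u) (Lock : Type v) where
  | assign (x : Var) (E : AExp Var)
  | load (x : Var) (E : AExp Var)
  | store (E E' : AExp Var)
  | skip
  | alloc (x : Var) (E : AExp Var)
  | dispose (E : AExp Var)
  | seq (C C' : Cmd Var Lock)
  | par (C C' : Cmd Var Lock)
  | ite (B : BExp Var) (C C' : Cmd Var Lock)
  | while (B : BExp Var) (C : Cmd Var Lock)
  | resource (r : Lock) (C : Cmd Var Lock)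
  | withWhen (r : Lock) (B : BExp Var) (C : Cmd Var Lock)

open TransSys in
/-- The transition system of a command. -/
def Cmd.sem {Var : Type u} {Lock : Type v} : Cmd Var Lock → TransSys Var Lock
  | .assign x E => ofInstr (.assign x E)
  | .load x E => ofInstr (.load x E)
  | .store E E' => ofInstr (.store E E')
  | .skip => ofInstr .nop
  | .alloc x E => ofInstr (.alloc x E)
  | .dispose E => ofInstr (.dispose E)
  | .seq C C' => C.sem.seq C'.sem
  | .par C C' => C.sem.par C'.sem
  | .ite B C C' =>
      ((((ofInstr .nop).when B true).seq C.sem).union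
        (((ofInstr .nop).when B false).seq C'.sem)).union (whenAbort B)
  | .while B C =>
      iUnion fun n => (fun T =>
        (((((ofInstr .nop).when B true).seq C.sem).seq T).union
          ((ofInstr .nop).when B false)).union (whenAbort B))^[n] empty
  | .resource r C => C.sem.hide r
  | .withWhen r B C => ((C.sem.inside r).when B true).union (whenAbort B)

/-! ## Permissions and logical states -/

/-- Permission monoids: partial cancellative commutative monoids whose unit is adjoined (it is
represented by absence of permission, and is not a member of `Perm`), with a permission `top` that
has no multiple by an element of `Perm`. The law `comp_ne` is cancellativity with respect to the
adjoined unit. -/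
class PermMonoid (Perm : Type w) where
  comp : Perm → Perm → Option Perm
  top : Perm
  comp_comm : ∀ p q, comp p q = comp q p
  comp_assoc : ∀ p q r, ((comp p q).bind fun x => comp x r) = (comp q r).bind fun x => comp p x
  comp_cancel : ∀ p q q' x, comp p q = some x → comp p q' = some x → q = q'
  comp_ne : ∀ p q, comp p q ≠ some p
  top_comp : ∀ p, comp top p = none

/-- Logical states: stacks and heaps whose cells carry a value and a permission. -/
abbrev LState (Var : Type u) (Perm : Type w) := FinPMap (Var ⊕ ℕ) (ℤ × Perm)

section Logical

variable {Var : Type u} {Perm : Type w}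

/-- The memory state underlying a logical state. -/
def LState.forget (σ : LState Var Perm) : State Var := FinPMap.map Prod.fst σ

variable [PermMonoid Perm]

/-- Separation product of two optional cells; the outer option records definedness. -/
def cellStar : Option (ℤ × Perm) → Option (ℤ × Perm) → Option (Option (ℤ × Perm))
  | none, b => some b
  | a, none => some a
  | some (n, p), some (k, q) =>
      if n = k then (PermMonoid.comp p q).map fun r => some (n, r) else none

theorem cellStar_none_left (b : Option (ℤ × Perm)) : cellStar none b = some b := rfl

theorem cellStar_none_right (a : Option (ℤ × Perm)) : cellStar a none = some a := by
  cases a <;> rfl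

theorem cellStar_comm (a b : Option (ℤ × Perm)) : cellStar a b = cellStar b a := by
  rcases a with _ | ⟨n, p⟩ <;> rcases b with _ | ⟨k, q⟩ <;> try rfl
  by_cases h : n = k
  · subst h
    simp [cellStar, PermMonoid.comp_comm p q]
  · simp [cellStar, h, Ne.symm h]

theorem cellStar_assoc (a b c : Option (ℤ × Perm)) :
    ((cellStar a b).bind fun x => cellStar x c) = (cellStar b c).bind fun x => cellStar a x := by
  rcases a with _ | ⟨n, p⟩
  · cases h : cellStar b c <;> simp [cellStar_none_left, h]
  rcases b with _ | ⟨k, q⟩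
  · simp [cellStar_none_left, cellStar_none_right]
  rcases c with _ | ⟨m, r⟩
  · cases h : cellStar (some (n, p)) (some (k, q)) <;> simp [cellStar_none_right, h]
  have key := PermMonoid.comp_assoc p q r
  by_cases h : n = k <;> by_cases h' : k = m
  · subst h h'
    cases h₁ : PermMonoid.comp p q <;> cases h₂ : PermMonoid.comp q r <;>
      simp_all [cellStar]
    simp [← key]
  · subst h
    cases h₁ : PermMonoid.comp p q <;> simp [cellStar, h', h₁]
  · subst h'
    cases h₁ : PermMonoid.comp q r <;> simp [cellStar, h, h₁]
  · simp [cellStar, h, h']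

open Classical in
/-- Separation product of logical states: `some ρ` when it is defined and equal to `ρ`, and `none`
when it is not defined. -/
noncomputable def LState.star (σ τ : LState Var Perm) : Option (LState Var Perm) :=
  if ∀ a, cellStar (σ a) (τ a) ≠ none then
    some
      { toFun := fun a => (cellStar (σ a) (τ a)).join
        finite_dom := by
          refine (σ.finite.union τ.finite).subset ?_
          intro a ha
          by_contra h
          simp only [Set.mem_union, Set.mem_ofPred_eq, not_or, not_not] at h
          simp [h.1, h.2, cellStar] at ha }
  else none

theorem LState.star_eq_some {σ τ ρ : LState Var Perm} :
    σ.star τ = some ρ ↔ ∀ a, cellStar (σ a) (τ a) = some (ρ a) := by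
  unfold LState.star
  constructor
  · intro h a
    split_ifs at h with hd
    obtain ⟨x, hx⟩ := Option.ne_none_iff_exists'.1 (hd a)
    have : ρ a = (cellStar (σ a) (τ a)).join := by
      rw [← Option.some.inj h]; rfl
    rw [this, hx]; rfl
  · intro h
    rw [if_pos fun a => by simp [h a]]
    congr 1
    refine DFunLike.ext _ _ fun a => ?_
    change (cellStar (σ a) (τ a)).join = ρ a
    rw [h a]; rfl

theorem LState.star_assoc (σ τ κ : LState Var Perm) :
    ((σ.star τ).bind fun x => x.star κ) = (τ.star κ).bind fun x => σ.star x := by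
  have exist : ∀ (α β : LState Var Perm), (∀ a, ∃ x, cellStar (α a) (β a) = some x) →
      ∃ ρ, α.star β = some ρ := by
    intro α β h
    unfold LState.star
    rw [if_pos fun a => by obtain ⟨x, hx⟩ := h a; simp [hx]]
    exact ⟨_, rfl⟩
  refine Option.ext fun ρ => ?_
  simp only [Option.bind_eq_some_iff]
  constructor
  · rintro ⟨ν, h, h'⟩
    rw [star_eq_some] at h h'
    have cell : ∀ a, ∃ x, cellStar (τ a) (κ a) = some x ∧ cellStar (σ a) x = some (ρ a) := by
      intro a
      have := cellStar_assoc (σ a) (τ a) (κ a)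
      rw [h a, Option.bind_some, h' a] at this
      exact Option.bind_eq_some_iff.1 this.symm
    obtain ⟨θ, hθ⟩ := exist τ κ fun a => (cell a).imp fun _ hx => hx.1
    refine ⟨θ, hθ, star_eq_some.2 fun a => ?_⟩
    obtain ⟨x, hx, hx'⟩ := cell a
    rw [star_eq_some] at hθ
    rw [hθ a] at hx
    rw [Option.some.inj hx, hx']
  · rintro ⟨ν, h, h'⟩
    rw [star_eq_some] at h h'
    have cell : ∀ a, ∃ x, cellStar (σ a) (τ a) = some x ∧ cellStar x (κ a) = some (ρ a) := by
      intro a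
      have := cellStar_assoc (σ a) (τ a) (κ a)
      rw [h a, Option.bind_some, h' a] at this
      exact Option.bind_eq_some_iff.1 this
    obtain ⟨θ, hθ⟩ := exist σ τ fun a => (cell a).imp fun _ hx => hx.1
    refine ⟨θ, hθ, star_eq_some.2 fun a => ?_⟩
    obtain ⟨x, hx, hx'⟩ := cell a
    rw [star_eq_some] at hθ
    rw [hθ a] at hx
    rw [Option.some.inj hx, hx']

theorem LState.star_comm (σ τ : LState Var Perm) : σ.star τ = τ.star σ := by
  refine Option.ext fun ρ => ?_
  rw [star_eq_some, star_eq_some]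
  exact forall_congr' fun a => by rw [cellStar_comm]

theorem LState.empty_star (σ : LState Var Perm) : LState.star FinPMap.empty σ = some σ :=
  star_eq_some.2 fun a => cellStar_none_left (σ a)

/-- The separation product as a total operation on `Option (LState Var Perm)`, where `none` means
undefined and is absorbing; its unit is the empty logical state. -/
noncomputable instance LState.instCommMonoid : CommMonoid (Option (LState Var Perm)) where
  mul x y := x.bind fun σ => y.bind fun τ => σ.star τ
  one := some FinPMap.empty
  mul_assoc x y z := by
    change ((x.bind fun σ => y.bind fun τ => σ.star τ).bind fun ν => z.bind fun κ => ν.star κ) =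
      x.bind fun σ => (y.bind fun τ => z.bind fun κ => τ.star κ).bind fun ν => σ.star ν
    cases x <;> cases y <;> cases z <;> simp [LState.star_assoc]
  one_mul x := by
    change ((some FinPMap.empty).bind fun σ => x.bind fun τ => LState.star σ τ) = x
    cases x <;> simp [LState.empty_star]
  mul_one x := by
    change (x.bind fun σ => (some FinPMap.empty).bind fun τ => LState.star σ τ) = x
    cases x <;> simp [LState.star_comm _ FinPMap.empty, LState.empty_star]
  mul_comm x y := by
    change (x.bind fun σ => y.bind fun τ => σ.star τ) = y.bind fun σ => x.bind fun τ => σ.star τ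
    cases x <;> cases y <;> simp [LState.star_comm]

end Logical

/-! ## Predicates -/

/-- Predicates on logical states. Conjunction, negation and entailment of predicates are the
pointwise `⊓`, `ᶜ` and `≤`; the predicate `True` is `⊤`. -/
abbrev Assertion (Var : Type u) (Perm : Type w) := LState Var Perm → Prop

/-- Contexts: partial functions from resources to predicates (the invariants). -/
abbrev Ctx (Var : Type u) (Lock : Type v) (Perm : Type w) := Lock → Option (Assertion Var Perm)

namespace Assertion

variable {Var : Type u} {Lock : Type v} {Perm : Type w}

/-- `own_p(x)`. -/
def own (p : Perm) (x : Var) : Assertion Var Perm := fun σ => ∃ n, σ (Sum.inl x) = some (n, p)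

/-- `E = F`; it includes that the variables of `E` and `F` are in the domain of the stack. -/
def eq (E F : AExp Var) : Assertion Var Perm :=
  fun σ => ∃ n, E.eval σ.forget = some n ∧ F.eval σ.forget = some n

/-- `E ↦^p F`: the heap consists of one cell, at the location `E`, with value `F` and
permission `p`. -/
def pointsTo (E : AExp Var) (p : Perm) (F : AExp Var) : Assertion Var Perm :=
  fun σ => ∃ (l : ℕ) (n : ℤ), E.eval σ.forget = some (l : ℤ) ∧ F.eval σ.forget = some n ∧
    σ (Sum.inr l) = some (n, p) ∧ ∀ l', l' ≠ l → σ (Sum.inr l') = none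

/-- The boolean expression `B` seen as a predicate. -/
def holds (B : BExp Var) : Assertion Var Perm := fun σ => B.eval σ.forget = some true

/-- `def(B)`: the variables of `B` are in the domain of the stack. -/
def defined (B : BExp Var) : Assertion Var Perm :=
  fun σ => ∀ x ∈ B.fv, σ (Sum.inl x) ≠ none

/-- `def(E)`: the variables of `E` are in the domain of the stack. -/
def definedExp (E : AExp Var) : Assertion Var Perm :=
  fun σ => ∀ x ∈ E.fv, σ (Sum.inl x) ≠ none

variable [PermMonoid Perm]

/-- Separating conjunction. -/
def sep (P Q : Assertion Var Perm) : Assertion Var Perm :=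
  fun σ => ∃ σ₁ σ₂, σ₁.star σ₂ = some σ ∧ P σ₁ ∧ Q σ₂

/-- Precise predicates. -/
def Precise (P : Assertion Var Perm) : Prop :=
  ∀ σ σ₁ σ₂ : LState Var Perm,
    ((∃ τ, σ₁.star τ = some σ) ∧ P σ₁) → ((∃ τ, σ₂.star τ = some σ) ∧ P σ₂) → σ₁ = σ₂

end Assertion

/-- Precise contexts. -/
def Ctx.Precise {Var : Type u} {Lock : Type v} {Perm : Type w} [PermMonoid Perm]
    (Γ : Ctx Var Lock Perm) : Prop :=
  ∀ r, ∀ J ∈ Γ r, Assertion.Precise J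

/-! ## The logic -/

open Assertion PermMonoid in
/-- Derivation trees of `Γ ⊢ {P} C {Q}`. -/
inductive Derivation {Var : Type u} {Lock : Type v} {Perm : Type w} [PermMonoid Perm]
    [DecidableEq Lock] : Ctx Var Lock Perm → Assertion Var Perm → Cmd Var Lock →
      Assertion Var Perm → Type (max u v w)
  | aff {Γ : Ctx Var Lock Perm} (x : Var) (E : AExp Var) (X : ℤ) :
      Derivation Γ (own top x ⊓ eq (.const X) E) (.assign x E)
        (own top x ⊓ eq (.var x) (.const X))
  | store {Γ : Ctx Var Lock Perm} (E E' : AExp Var) :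
      Derivation Γ ((fun σ => ∃ n, pointsTo E top (.const n) σ) ⊓ definedExp E') (.store E E')
        (pointsTo E top E')
  | load {Γ : Ctx Var Lock Perm} (x : Var) (E : AExp Var) (p : Perm) (n : ℤ) :
      x ∉ E.fv →
      Derivation Γ (sep (pointsTo E p (.const n)) (own top x)) (.load x E)
        (sep (pointsTo E p (.const n)) (own top x ⊓ eq (.var x) (.const n)))
  | seq {Γ : Ctx Var Lock Perm} {P Q R : Assertion Var Perm} {C C' : Cmd Var Lock} :
      Derivation Γ P C Q → Derivation Γ Q C' R → Derivation Γ P (.seq C C') R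
  | ite {Γ : Ctx Var Lock Perm} {P Q : Assertion Var Perm} {B : BExp Var}
      {C₁ C₂ : Cmd Var Lock} :
      P ≤ defined B → Derivation Γ (P ⊓ holds B) C₁ Q → Derivation Γ (P ⊓ (holds B)ᶜ) C₂ Q →
      Derivation Γ P (.ite B C₁ C₂) Q
  | conj {Γ : Ctx Var Lock Perm} {P₁ P₂ Q₁ Q₂ : Assertion Var Perm} {C : Cmd Var Lock} :
      Γ.Precise → Derivation Γ P₁ C Q₁ → Derivation Γ P₂ C Q₂ →
      Derivation Γ (P₁ ⊓ P₂) C (Q₁ ⊓ Q₂)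
  | res {Γ : Ctx Var Lock Perm} {r : Lock} {J P Q : Assertion Var Perm} {C : Cmd Var Lock} :
      Γ r = none → Derivation (Function.update Γ r (some J)) P C Q →
      Derivation Γ (sep P J) (.resource r C) (sep Q J)
  | withWhen {Γ : Ctx Var Lock Perm} {r : Lock} {J P Q : Assertion Var Perm} {B : BExp Var}
      {C : Cmd Var Lock} :
      Γ r = none → P ≤ defined B → Derivation Γ (sep P J ⊓ holds B) C (sep Q J) →
      Derivation (Function.update Γ r (some J)) P (.withWhen r B C) Q
  | par {Γ : Ctx Var Lock Perm} {P₁ P₂ Q₁ Q₂ : Assertion Var Perm} {C₁ C₂ : Cmd Var Lock} :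
      Derivation Γ P₁ C₁ Q₁ → Derivation Γ P₂ C₂ Q₂ →
      Derivation Γ (sep P₁ P₂) (.par C₁ C₂) (sep Q₁ Q₂)
  | frame {Γ : Ctx Var Lock Perm} {P Q R : Assertion Var Perm} {C : Cmd Var Lock} :
      Derivation Γ P C Q → Derivation Γ (sep P R) C (sep Q R)
  | conseq {Γ : Ctx Var Lock Perm} {P P' Q Q' : Assertion Var Perm} {C : Cmd Var Lock} :
      P' ≤ P → Derivation Γ P C Q → Q ≤ Q' → Derivation Γ P' C Q'

/-! ## Separated states -/

/-- The status of a resource in a separated state: available with a logical state, or locked and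
owned by the Code, or locked and owned by the Frame. -/
inductive Status (Var : Type u) (Perm : Type w) where
  | avail (σ : LState Var Perm)
  | code
  | frame

/-- The logical state attached to a resource (the unit when the resource is locked). -/
noncomputable def Status.logical {Var : Type u} {Perm : Type w} [PermMonoid Perm] :
    Status Var Perm → Option (LState Var Perm)
  | .avail σ => some σ
  | .code => 1
  | .frame => 1

/-- Separated states. -/
@[ext]
structure SState (Var : Type u) (Lock : Type v) (Perm : Type w) [PermMonoid Perm]
    [Fintype Lock] where
  code : LState Var Perm
  res : Lock → Status Var Perm
  frame : LState Var Perm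
  defined : (some code * (∏ r, (res r).logical) * some frame).isSome

namespace SState

variable {Var : Type u} {Lock : Type v} {Perm : Type w} [PermMonoid Perm] [Fintype Lock]

/-- Resources available in a separated state. -/
def dom (z : SState Var Lock Perm) : Set Lock := {r | ∃ σ, z.res r = .avail σ}

/-- Resources locked by the Code. -/
def domC (z : SState Var Lock Perm) : Set Lock := {r | z.res r = .code}

/-- Resources locked by the Frame. -/
def domF (z : SState Var Lock Perm) : Set Lock := {r | z.res r = .frame}

/-- The machine state into which a separated state combines. -/
noncomputable def combine (z : SState Var Lock Perm) : MState Var Lock where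
  mem := ((some z.code * (∏ r, (z.res r).logical) * some z.frame).get z.defined).forget
  locks := z.domC ∪ z.domF

end SState

/-! ## Paths -/

/-- Labels of transitions: the Environment (moves of Adam) or an instruction (moves of Eve). -/
inductive Label (Var : Type u) (Lock : Type v) where
  | env
  | instr (m : Instr Var Lock)

/-- Finite paths: an initial vertex followed by labelled transitions. -/
@[ext]
structure Path (V : Type w) (Lab : Type v) where
  start : V
  moves : List (Lab × V)

namespace Path

variable {V : Type w} {W : Type u} {Lab : Type v}

/-- The vertices of a path, in order. -/
def vertices (π : Path V Lab) : List V := π.start :: π.moves.map Prod.snd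

/-- The path `π` extended by one transition. -/
def snoc (π : Path V Lab) (a : Lab) (x : V) : Path V Lab := ⟨π.start, π.moves ++ [(a, x)]⟩

/-- `π` is an initial segment of `π'`. -/
def Initial (π π' : Path V Lab) : Prop := π.start = π'.start ∧ π.moves <+: π'.moves

def map (f : V → W) (π : Path V Lab) : Path W Lab :=
  ⟨f π.start, π.moves.map fun e => (e.1, f e.2)⟩

/-- From `x`, the given transitions are consecutive edges of the graph `edge`. -/
def Walk (edge : V → Lab → V → Prop) : V → List (Lab × V) → Prop
  | _, [] => True
  | x, (a, y) :: l => edge x a y ∧ Walk edge y l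

/-- `π` is a path in the graph `edge`. -/
def IsIn (edge : V → Lab → V → Prop) (π : Path V Lab) : Prop := Walk edge π.start π.moves

end Path

/-- A trace seen as an alternating path in the graph of machine states. -/
def Trace.path {Var : Type u} {Lock : Type v} (t : Trace Var Lock) :
    Path (MState Var Lock) (Label Var Lock) where
  start := t.source
  moves := (t.steps.flatMap fun st => [(.env, st.pre), (.instr st.instr, st.post)]) ++
    [(.env, t.target)]

/-! ## Separation games -/

section Games

variable {Var : Type u} {Lock : Type v} {Perm : Type w} [PermMonoid Perm] [Fintype Lock]

/-- The graph of separated states: the moves of Adam and of Eve. -/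
def SState.Edge (z₁ : SState Var Lock Perm) (a : Label Var Lock) (z₂ : SState Var Lock Perm) :
    Prop :=
  match a with
  | .env => z₂.code = z₁.code ∧ z₂.domC = z₁.domC
  | .instr m =>
      z₂.frame = z₁.frame ∧
      Returns z₁.combine m z₂.combine ∧
      (∀ r, r ∉ m.locksTaken ∪ m.locksReleased → z₁.res r = z₂.res r) ∧
      (∀ r ∈ m.locksTaken, r ∈ z₁.dom ∧ r ∈ z₂.domC) ∧
      (∀ r ∈ m.locksReleased, r ∈ z₁.domC ∧ r ∈ z₂.dom)

/-- The plays of the separation game of `t`: the paths of separated states which combine into an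
initial segment of `t`. -/
def SGame (Perm : Type w) [PermMonoid Perm] (t : Trace Var Lock) :
    Set (Path (SState Var Lock Perm) (Label Var Lock)) :=
  {π | π.IsIn SState.Edge ∧ (π.map SState.combine).Initial t.path}

/-- Separated predicates. -/
structure SPred (Var : Type u) (Lock : Type v) (Perm : Type w) where
  code : Assertion Var Perm
  ctx : Ctx Var Lock Perm
  frame : Assertion Var Perm

/-- Satisfaction of a separated predicate; the available resources that are declared in the context
satisfy their invariants. -/
def SPred.Sat (z : SState Var Lock Perm) (A : SPred Var Lock Perm) : Prop :=
  A.code z.code ∧ A.frame z.frame ∧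
    ∀ r σ, z.res r = .avail σ → ∀ J ∈ A.ctx r, J σ

/-- The separated predicate imposed on the `i`-th state, `i = 1, …, 2p+2`, of a play in the
game of a trace `t` of length `p` of the command `C`: the Code satisfies `P` at the start, and it
satisfies `Q` after its last transition and at the end when `t` returns. -/
def winPred (Γ : Ctx Var Lock Perm) (P : Assertion Var Perm) (C : Cmd Var Lock)
    (Q : Assertion Var Perm) (t : Trace Var Lock) (i : ℕ) : SPred Var Lock Perm where
  code := fun σ => (i = 1 → P σ) ∧ (t ∈ C.sem.ret → 2 * t.length + 1 ≤ i → Q σ)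
  ctx := Γ
  frame := ⊤

/-- Winning plays. -/
def WinningPlay (Γ : Ctx Var Lock Perm) (P : Assertion Var Perm) (C : Cmd Var Lock)
    (Q : Assertion Var Perm) (t : Trace Var Lock)
    (π : Path (SState Var Lock Perm) (Label Var Lock)) : Prop :=
  ∀ i, ∀ z ∈ π.vertices[i]?, SPred.Sat z (winPred Γ P C Q t (i + 1))

/-- Strategies of the separation game of `t`: sets of plays closed under initial segments. -/
structure IsStrategy (t : Trace Var Lock)
    (S : Set (Path (SState Var Lock Perm) (Label Var Lock))) : Prop where
  plays : S ⊆ SGame Perm t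
  closed : ∀ π ∈ S, ∀ π', π'.Initial π → π' ∈ S

/-- Winning strategies of the separation game of `t` determined by `Γ ⊢ {P} C {Q}`. -/
structure IsWinningStrategy (Γ : Ctx Var Lock Perm) (P : Assertion Var Perm) (C : Cmd Var Lock)
    (Q : Assertion Var Perm) (t : Trace Var Lock)
    (S : Set (Path (SState Var Lock Perm) (Label Var Lock))) : Prop extends IsStrategy t S where
  /-- it contains only winning plays -/
  winning : ∀ π ∈ S, WinningPlay Γ P C Q t π
  /-- it contains every empty and winning play -/
  start : ∀ z : SState Var Lock Perm, ⟨z, []⟩ ∈ SGame Perm t →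
    WinningPlay Γ P C Q t ⟨z, []⟩ → ⟨z, []⟩ ∈ S
  /-- it accepts every winning move of Adam, and Eve answers it, unless it was the last transition
  of the trace -/
  answer : ∀ π ∈ S, ∀ z₁ : SState Var Lock Perm, π.snoc .env z₁ ∈ SGame Perm t →
    WinningPlay Γ P C Q t (π.snoc .env z₁) →
    π.snoc .env z₁ ∈ S ∧
      (π.moves.length + 1 < t.path.moves.length →
        ∃ (m : Instr Var Lock) (z₂ : SState Var Lock Perm),
          (π.snoc .env z₁).snoc (.instr m) z₂ ∈ S)

end Games

end CSL

/-!
The strategy of Eve is read off a safety property of the Code. `Safe Γ R l D σ` says that a Code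
which owns the logical state `σ` and the locks `D` can answer the list `l` of Code transitions one
after the other: in each separated state which combines into the source of the transition, whose
Code part is the current one and which respects the invariants, there is a successful move to a
separated state which combines into its target and respects the invariants. Adam never changes `σ`
and `D`, so this is exactly what Eve needs; `safeStrategy_isWinning` turns safety along a trace into
a winning strategy, made of the winning plays that stay safe.

`Derivation.sound` proves by induction on the derivation that the traces of the command are safe,
and that the returning ones moreover end in the postcondition with the locks owned at the start.
The structural rules reinterpret separated states so that the game of a premise can be played inside
that of the conclusion.

* Parallel composition (`exists_answer_of_part`): for one thread, the logical state and the locks of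
  the other one belong to the Frame. The frame rule is the case of a thread without transitions.
* Resource declaration (`exists_answer_hide`): inside the declaration, `r` is available with its
  invariant or locked by the Code. Outside, that state belongs to the Code, and whatever logical
  state is attached to `r` is given to the Frame of the inside game. Privacy of `r` makes the lock
  status known inside the declaration agree with the trace.
* Critical section (`Sound.withWhen`): acquiring `r` brings its invariant to the Code and releasing
  it gives the invariant back. In between the Code holds `r`, so that the game of the body does not
  see whether the context declares `r`.
* Conjunction (`Answer.unique`): the two strategies have to make the same moves. Machine states do
  not record permissions, so the game alone does not determine the moves of Eve; it does so once they
  are required to keep the permissions of the total state, and the invariants are precise.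
* Assignment, load and store (`exists_answer_put`): the permission `⊤` excludes any other share of
  the written cell.
-/

namespace CSL

universe u v w

/-! ### Finite partial maps and expressions -/

namespace FinPMap

variable {α : Type u} {β : Type v}

theorem ext_apply {f g : FinPMap α β} (h : ∀ a, f a = g a) : f = g := DFunLike.ext _ _ h

theorem put_self (f : FinPMap α β) (a : α) (b : Option β) : f.put a b a = b := by
  classical exact Function.update_self (β := fun _ => Option β) a b f

theorem put_of_ne (f : FinPMap α β) {a a' : α} (b : Option β) (h : a' ≠ a) :
    f.put a b a' = f a' := by
  classical exact Function.update_of_ne (β := fun _ => Option β) h b f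

end FinPMap

section Expressions

variable {Var : Type u}

theorem AExp.eval_mono {μ μ' : State Var} (h : ∀ a n, μ a = some n → μ' a = some n) :
    ∀ (E : AExp Var) {n : ℤ}, E.eval μ = some n → E.eval μ' = some n
  | .const _, _, he => he
  | .var _, _, he => h _ _ he
  | .plus E F, n, he => by
    simp only [AExp.eval, Option.bind_eq_some_iff, Option.map_eq_some_iff] at he ⊢
    obtain ⟨a, ha, b, hb, hab⟩ := he
    exact ⟨a, E.eval_mono h ha, b, F.eval_mono h hb, hab⟩
  | .times E F, n, he => by
    simp only [AExp.eval, Option.bind_eq_some_iff, Option.map_eq_some_iff] at he ⊢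
    obtain ⟨a, ha, b, hb, hab⟩ := he
    exact ⟨a, E.eval_mono h ha, b, F.eval_mono h hb, hab⟩

theorem BExp.eval_mono {μ μ' : State Var} (h : ∀ a n, μ a = some n → μ' a = some n) :
    ∀ (B : BExp Var) {b : Bool}, B.eval μ = some b → B.eval μ' = some b
  | .true, _, he => he
  | .false, _, he => he
  | .and B B', _, he => by
    simp only [BExp.eval, Option.bind_eq_some_iff, Option.map_eq_some_iff] at he ⊢
    obtain ⟨a, ha, b, hb, hab⟩ := he
    exact ⟨a, B.eval_mono h ha, b, B'.eval_mono h hb, hab⟩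
  | .or B B', _, he => by
    simp only [BExp.eval, Option.bind_eq_some_iff, Option.map_eq_some_iff] at he ⊢
    obtain ⟨a, ha, b, hb, hab⟩ := he
    exact ⟨a, B.eval_mono h ha, b, B'.eval_mono h hb, hab⟩
  | .eq E F, _, he => by
    simp only [BExp.eval, Option.bind_eq_some_iff, Option.map_eq_some_iff] at he ⊢
    obtain ⟨a, ha, b, hb, hab⟩ := he
    exact ⟨a, E.eval_mono h ha, b, F.eval_mono h hb, hab⟩

theorem AExp.exists_eval {μ : State Var} :
    ∀ E : AExp Var, (∀ x ∈ E.fv, μ (Sum.inl x) ≠ none) → ∃ n, E.eval μ = some n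
  | .const n, _ => ⟨n, rfl⟩
  | .var x, h => Option.ne_none_iff_exists'.1 (h x rfl)
  | .plus E F, h => by
    obtain ⟨a, ha⟩ := E.exists_eval fun x hx => h x (Or.inl hx)
    obtain ⟨b, hb⟩ := F.exists_eval fun x hx => h x (Or.inr hx)
    exact ⟨a + b, by simp [AExp.eval, ha, hb]⟩
  | .times E F, h => by
    obtain ⟨a, ha⟩ := E.exists_eval fun x hx => h x (Or.inl hx)
    obtain ⟨b, hb⟩ := F.exists_eval fun x hx => h x (Or.inr hx)
    exact ⟨a * b, by simp [AExp.eval, ha, hb]⟩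

theorem BExp.exists_eval {μ : State Var} :
    ∀ B : BExp Var, (∀ x ∈ B.fv, μ (Sum.inl x) ≠ none) → ∃ b, B.eval μ = some b
  | .true, _ => ⟨_, rfl⟩
  | .false, _ => ⟨_, rfl⟩
  | .and B B', h => by
    obtain ⟨a, ha⟩ := B.exists_eval fun x hx => h x (Or.inl hx)
    obtain ⟨b, hb⟩ := B'.exists_eval fun x hx => h x (Or.inr hx)
    exact ⟨a && b, by simp [BExp.eval, ha, hb]⟩
  | .or B B', h => by
    obtain ⟨a, ha⟩ := B.exists_eval fun x hx => h x (Or.inl hx)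
    obtain ⟨b, hb⟩ := B'.exists_eval fun x hx => h x (Or.inr hx)
    exact ⟨a || b, by simp [BExp.eval, ha, hb]⟩
  | .eq E F, h => by
    obtain ⟨a, ha⟩ := E.exists_eval fun x hx => h x (Or.inl hx)
    obtain ⟨b, hb⟩ := F.exists_eval fun x hx => h x (Or.inr hx)
    exact ⟨decide (a = b), by simp [BExp.eval, ha, hb]⟩

/-- The heap is not read by the evaluation of an expression. -/
theorem AExp.eval_congr {μ μ' : State Var} (h : ∀ x, μ (Sum.inl x) = μ' (Sum.inl x)) :
    ∀ E : AExp Var, E.eval μ = E.eval μ'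
  | .const _ => rfl
  | .var x => h x
  | .plus E F => by simp only [AExp.eval, E.eval_congr h, F.eval_congr h]
  | .times E F => by simp only [AExp.eval, E.eval_congr h, F.eval_congr h]

end Expressions

/-! ### The separation product -/

section Product

variable {Var : Type u} {Perm : Type w}

theorem LState.forget_apply (σ : LState Var Perm) (a : Var ⊕ ℕ) :
    σ.forget a = (σ a).map Prod.fst := rfl

theorem LState.forget_put (σ : LState Var Perm) (a : Var ⊕ ℕ) (n : ℤ) (p : Perm) :
    LState.forget (σ.put a (some (n, p))) = σ.forget.put a (some n) := by
  refine FinPMap.ext_apply fun b => ?_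
  by_cases h : b = a
  · subst h; simp [LState.forget_apply, FinPMap.put_self]
  · simp [LState.forget_apply, FinPMap.put_of_ne _ _ h]

/-- The permissions of the cells of a logical state, without their values. -/
def LState.perms (σ : LState Var Perm) (a : Var ⊕ ℕ) : Option Perm := (σ a).map Prod.snd

theorem LState.perms_put (σ : LState Var Perm) {a : Var ⊕ ℕ} {n : ℤ} {p : Perm}
    (h : σ a = some (n, p)) (m : ℤ) : LState.perms (σ.put a (some (m, p))) = σ.perms := by
  funext b
  by_cases hb : b = a
  · subst hb; simp [LState.perms, FinPMap.put_self, h]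
  · simp [LState.perms, FinPMap.put_of_ne _ _ hb]

theorem LState.ext_forget_perms {σ τ : LState Var Perm} (h : σ.forget = τ.forget)
    (h' : σ.perms = τ.perms) : σ = τ := by
  refine FinPMap.ext_apply fun a => ?_
  have h₁ : (σ a).map Prod.fst = (τ a).map Prod.fst := DFunLike.congr_fun h a
  have h₂ : (σ a).map Prod.snd = (τ a).map Prod.snd := congrFun h' a
  cases hσ : σ a <;> cases hτ : τ a <;> simp_all [Prod.ext_iff]

variable [PermMonoid Perm]

theorem cellStar_cancel {a a' b c : Option (ℤ × Perm)} (h : cellStar a b = some c)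
    (h' : cellStar a' b = some c) : a = a' := by
  -- A cell cannot absorb another one: this is cancellation against the adjoined unit.
  have key : ∀ (x y : ℤ × Perm), cellStar (some x) (some y) ≠ some (some y) := by
    rintro ⟨n, p⟩ ⟨k, q⟩ h
    by_cases hnk : n = k
    · simp only [cellStar, hnk, if_true, Option.map_eq_some_iff, Option.some.injEq,
        Prod.mk.injEq, true_and] at h
      obtain ⟨r, hr, rfl⟩ := h
      exact PermMonoid.comp_ne r p (by rw [PermMonoid.comp_comm, hr])
    · simp [cellStar, hnk] at h
  rcases b with _ | ⟨k, q⟩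
  · rw [cellStar_none_right] at h h'
    exact Option.some.inj (h.trans h'.symm)
  · rcases a with _ | ⟨n, p⟩ <;> rcases a' with _ | ⟨n', p'⟩
    · rfl
    · rw [cellStar_none_left] at h
      exact absurd (h'.trans h.symm) (key _ _)
    · rw [cellStar_none_left] at h'
      exact absurd (h.trans h'.symm) (key _ _)
    · by_cases hn : n = k <;> by_cases hn' : n' = k <;> simp [cellStar, hn, hn'] at h h'
      obtain ⟨r, hr, hrc⟩ := h
      obtain ⟨r', hr', hrc'⟩ := h'
      rw [← hrc] at hrc'
      simp only [Option.some.injEq, Prod.mk.injEq, true_and] at hrc'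
      subst hn hn' hrc'
      rw [PermMonoid.comp_comm] at hr hr'
      rw [PermMonoid.comp_cancel _ _ _ _ hr hr']

namespace LState

theorem star_cancel {σ σ' ρ τ : LState Var Perm} (h : σ.star ρ = some τ)
    (h' : σ'.star ρ = some τ) : σ = σ' := by
  rw [star_eq_some] at h h'
  exact FinPMap.ext_apply fun a => cellStar_cancel (h a) (h' a)

theorem some_mul_some (σ τ : LState Var Perm) :
    (some σ * some τ : Option (LState Var Perm)) = σ.star τ := rfl

theorem exists_of_mul_eq_some {x y : Option (LState Var Perm)} {τ : LState Var Perm}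
    (h : x * y = some τ) : ∃ σ ρ, x = some σ ∧ y = some ρ ∧ σ.star ρ = some τ := by
  change (x.bind fun σ => y.bind fun τ => σ.star τ) = some τ at h
  simp only [Option.bind_eq_some_iff] at h
  obtain ⟨σ, hσ, ρ, hρ, h⟩ := h
  exact ⟨σ, ρ, hσ, hρ, h⟩

theorem mul_cancel {σ σ' τ : LState Var Perm} {x : Option (LState Var Perm)}
    (h : some σ * x = some τ) (h' : some σ' * x = some τ) : σ = σ' := by
  obtain ⟨_, ρ, e, hx, hs⟩ := exists_of_mul_eq_some h
  obtain ⟨_, ρ', e', hx', hs'⟩ := exists_of_mul_eq_some h'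
  cases e; cases e'
  cases hx.symm.trans hx'
  exact star_cancel hs hs'

theorem star_apply_some {σ ρ τ : LState Var Perm} (h : σ.star ρ = some τ) {a : Var ⊕ ℕ} {n : ℤ}
    {p : Perm} (ha : σ a = some (n, p)) : ∃ q, τ a = some (n, q) := by
  have := star_eq_some.1 h a
  rw [ha] at this
  rcases hρ : ρ a with _ | ⟨k, q⟩ <;> rw [hρ] at this
  · exact ⟨p, by simpa [cellStar] using this.symm⟩
  · by_cases hk : n = k
    · simp only [cellStar, hk, if_true, Option.map_eq_some_iff] at this
      obtain ⟨r, _, hr⟩ := this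
      exact ⟨r, by rw [← hr, hk]⟩
    · simp [cellStar, hk] at this

theorem star_forget_mono {σ ρ τ : LState Var Perm} (h : σ.star ρ = some τ) (a : Var ⊕ ℕ) (n : ℤ)
    (ha : σ.forget a = some n) : τ.forget a = some n := by
  rw [forget_apply, Option.map_eq_some_iff] at ha
  obtain ⟨⟨n', p⟩, ha, rfl⟩ := ha
  obtain ⟨q, hq⟩ := star_apply_some h ha
  simp [forget_apply, hq]

/-- The permission `top` excludes every other share of the cell. -/
theorem star_top_right {σ ρ τ : LState Var Perm} (h : σ.star ρ = some τ) {a : Var ⊕ ℕ} {n : ℤ}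
    (ha : σ a = some (n, PermMonoid.top)) : ρ a = none ∧ τ a = some (n, PermMonoid.top) := by
  have := star_eq_some.1 h a
  rw [ha] at this
  rcases hρ : ρ a with _ | ⟨k, q⟩ <;> rw [hρ] at this
  · exact ⟨rfl, by simpa [cellStar] using this.symm⟩
  · by_cases hk : n = k <;> simp [cellStar, hk, PermMonoid.top_comp] at this

theorem star_put {σ ρ τ : LState Var Perm} (h : σ.star ρ = some τ) {a : Var ⊕ ℕ} {n : ℤ}
    (ha : σ a = some (n, PermMonoid.top)) (m : ℤ) :
    LState.star (σ.put a (some (m, PermMonoid.top))) ρ =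
      some (τ.put a (some (m, PermMonoid.top))) := by
  refine star_eq_some.2 fun b => ?_
  by_cases hb : b = a
  · subst hb
    rw [FinPMap.put_self, FinPMap.put_self, (star_top_right h ha).1, cellStar_none_right]
  · rw [FinPMap.put_of_ne _ _ hb, FinPMap.put_of_ne _ _ hb]
    exact star_eq_some.1 h b

end LState

end Product

/-! ### Separated states with a given product -/

namespace SState

variable {Var : Type u} {Lock : Type v} {Perm : Type w} [PermMonoid Perm] [Fintype Lock]

/-- The product of all the components of a separated state. -/
noncomputable def total (z : SState Var Lock Perm) : LState Var Perm :=
  (some z.code * (∏ r, (z.res r).logical) * some z.frame).get z.defined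

theorem some_total (z : SState Var Lock Perm) :
    some z.code * (∏ r, (z.res r).logical) * some z.frame = some z.total :=
  (Option.some_get z.defined).symm

theorem combine_mem (z : SState Var Lock Perm) : z.combine.mem = z.total.forget := rfl

theorem combine_locks (z : SState Var Lock Perm) : z.combine.locks = z.domC ∪ z.domF := rfl

/-- The separated state with the given components, whose product is `τ`. -/
def ofProd (code : LState Var Perm) (res : Lock → Status Var Perm) (frame τ : LState Var Perm)
    (h : some code * (∏ r, (res r).logical) * some frame = some τ) : SState Var Lock Perm :=
  ⟨code, res, frame, by rw [h]; rfl⟩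

theorem ofProd_total {code : LState Var Perm} {res : Lock → Status Var Perm}
    {frame τ : LState Var Perm}
    (h : some code * (∏ r, (res r).logical) * some frame = some τ) :
    (ofProd code res frame τ h).total = τ :=
  Option.some.inj ((some_total _).symm.trans h)

theorem mem_locks {z : SState Var Lock Perm} {r : Lock} :
    r ∈ z.combine.locks ↔ ∀ σ, z.res r ≠ .avail σ := by
  change z.res r = .code ∨ z.res r = .frame ↔ _
  cases z.res r <;> simp

theorem exists_avail {z : SState Var Lock Perm} {r : Lock} (h : r ∉ z.combine.locks) :
    ∃ σ, z.res r = .avail σ := by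
  simpa [mem_locks] using h

/-- The Code's state is a factor of the total state. -/
theorem code_star (z : SState Var Lock Perm) : ∃ ρ, z.code.star ρ = some z.total := by
  have h := z.some_total
  rw [mul_assoc] at h
  obtain ⟨_, ρ, e, _, hs⟩ := LState.exists_of_mul_eq_some h
  cases e
  exact ⟨ρ, hs⟩

variable [DecidableEq Lock]

theorem prod_eq_mul_erase (f : Lock → Status Var Perm) (r : Lock) :
    ∏ r', (f r').logical = (f r).logical * ∏ r' ∈ Finset.univ.erase r, (f r').logical :=
  (Finset.mul_prod_erase _ _ (Finset.mem_univ r)).symm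

theorem prod_update (f : Lock → Status Var Perm) (r : Lock) (x : Status Var Perm) :
    ∏ r', (Function.update f r x r').logical =
      x.logical * ∏ r' ∈ Finset.univ.erase r, (f r').logical := by
  rw [prod_eq_mul_erase _ r, Function.update_self]
  congr 1
  refine Finset.prod_congr rfl fun r' hr' => ?_
  rw [Function.update_of_ne (Finset.ne_of_mem_erase hr')]

/-- The state of an available resource is a factor of the total state. -/
theorem avail_star {z : SState Var Lock Perm} {r : Lock} {σ : LState Var Perm}
    (h : z.res r = .avail σ) : ∃ ρ, σ.star ρ = some z.total := by
  have ht := z.some_total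
  rw [prod_eq_mul_erase _ r, h, mul_comm (some z.code), mul_assoc, mul_assoc] at ht
  obtain ⟨_, ρ, e, _, hs⟩ := LState.exists_of_mul_eq_some ht
  cases e
  exact ⟨ρ, hs⟩

end SState

/-! ### Safety of the Code along a trace -/

section Safety

variable {Var : Type u} {Lock : Type v} {Perm : Type w} [PermMonoid Perm] [Fintype Lock]

/-- The available resources declared in the context satisfy their invariants. -/
def SState.Respects (z : SState Var Lock Perm) (Γ : Ctx Var Lock Perm) : Prop :=
  ∀ r σ, z.res r = .avail σ → ∀ J ∈ Γ r, J σ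

/-- A move of Eve from `z` to `z'` that plays the Code transition `st`. Beyond the rules of the
game and the invariants, it leaves alone the resources outside the context, and it keeps the
permissions of the total state. The latter makes the move unique when the context is precise
(`Answer.unique`), although the game only fixes the total state up to permissions; it is
harmless because no rule of the logic allocates or disposes. -/
structure Answer (Γ : Ctx Var Lock Perm) (st : CodeStep Var Lock) (z z' : SState Var Lock Perm) :
    Prop where
  edge : z.Edge (.instr st.instr) z'
  combine_eq : z'.combine = st.post
  respects : z'.Respects Γ
  outside : ∀ r, Γ r = none → z'.res r = z.res r
  perms : z'.total.perms = z.total.perms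

/-- `Safe Γ R l D σ`: the Code, owning the logical state `σ` and the locks `D`, can answer all the
Code transitions in `l`, whatever the Environment does in between subject to the invariants of `Γ`,
and it finally owns locks and a logical state related by `R`. -/
def Safe (Γ : Ctx Var Lock Perm) (R : Set Lock → LState Var Perm → Prop) :
    List (CodeStep Var Lock) → Set Lock → LState Var Perm → Prop
  | [], D, σ => R D σ
  | st :: l, D, σ => ∀ z : SState Var Lock Perm, z.code = σ → z.domC = D → z.combine = st.pre →
      z.Respects Γ → ∃ z', Answer Γ st z z' ∧ Safe Γ R l z'.domC z'.code

/-- The Code owns exactly the locks `D` and satisfies `P`. -/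
def Owning (P : Assertion Var Perm) (D : Set Lock) (D' : Set Lock) (σ : LState Var Perm) : Prop :=
  D' = D ∧ P σ

/-- Started with locks and a logical state related by `P`, the Code is safe along all traces in
`T`, and the returning ones lead to `R`. -/
def Sound (Γ : Ctx Var Lock Perm) (P : Set Lock → LState Var Perm → Prop) (T : TransSys Var Lock)
    (R : Set Lock → LState Var Perm → Prop) : Prop :=
  ∀ D σ, P D σ → (∀ t ∈ T.traces, Safe Γ ⊤ t.steps D σ) ∧ ∀ t ∈ T.ret, Safe Γ R t.steps D σ

variable {Γ : Ctx Var Lock Perm} {P P' R R' : Set Lock → LState Var Perm → Prop}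

theorem Safe.mono (h : ∀ D σ, R D σ → R' D σ) :
    ∀ {l : List (CodeStep Var Lock)} {D : Set Lock} {σ : LState Var Perm},
      Safe Γ R l D σ → Safe Γ R' l D σ
  | [], _, _, hs => h _ _ hs
  | _ :: _, _, _, hs => fun z h₁ h₂ h₃ h₄ =>
    let ⟨z', ha, hs'⟩ := hs z h₁ h₂ h₃ h₄
    ⟨z', ha, hs'.mono h⟩

theorem Safe.of_append {l' : List (CodeStep Var Lock)} :
    ∀ {l : List (CodeStep Var Lock)} {D : Set Lock} {σ : LState Var Perm},
      Safe Γ R (l ++ l') D σ → Safe Γ ⊤ l D σ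
  | [], _, _, _ => trivial
  | _ :: _, _, _, hs => fun z h₁ h₂ h₃ h₄ =>
    let ⟨z', ha, hs'⟩ := hs z h₁ h₂ h₃ h₄
    ⟨z', ha, hs'.of_append⟩

theorem Safe.append {l' : List (CodeStep Var Lock)} (h : ∀ D σ, R D σ → Safe Γ R' l' D σ) :
    ∀ {l : List (CodeStep Var Lock)} {D : Set Lock} {σ : LState Var Perm},
      Safe Γ R l D σ → Safe Γ R' (l ++ l') D σ
  | [], _, _, hs => h _ _ hs
  | _ :: _, _, _, hs => fun z h₁ h₂ h₃ h₄ =>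
    let ⟨z', ha, hs'⟩ := hs z h₁ h₂ h₃ h₄
    ⟨z', ha, hs'.append h⟩

theorem Safe.of_initial {t t' : Trace Var Lock} {D : Set Lock} {σ : LState Var Perm}
    (h : t.Initial t') (hs : Safe Γ R t'.steps D σ) : Safe Γ ⊤ t.steps D σ := by
  obtain ⟨_, rest, e, _⟩ := h
  rw [e] at hs
  exact hs.of_append

/-- Completing a set of traces by its initial segments does not affect soundness. -/
theorem sound_generate {T T' : Set (Trace Var Lock)}
    (h : ∀ D σ, P D σ → ∀ t ∈ T, Safe Γ ⊤ t.steps D σ)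
    (h' : ∀ D σ, P D σ → ∀ t ∈ T', Safe Γ R t.steps D σ) :
    Sound Γ P (TransSys.generate T T') R := by
  refine fun D σ hP => ⟨?_, fun t ht => h' D σ hP t ht⟩
  rintro t ⟨t', ht' | ht', hi⟩
  · exact (h D σ hP t' ht').of_initial hi
  · exact (h' D σ hP t' ht').of_initial hi

theorem Sound.mono {T : TransSys Var Lock} (hP : ∀ D σ, P' D σ → P D σ) (h : Sound Γ P T R)
    (hR : ∀ D σ, R D σ → R' D σ) : Sound Γ P' T R' := fun D σ hσ =>
  ⟨(h D σ (hP D σ hσ)).1, fun t ht => ((h D σ (hP D σ hσ)).2 t ht).mono hR⟩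

theorem Sound.seq {T T' : TransSys Var Lock} (h : Sound Γ P T R) (h' : Sound Γ R T' R') :
    Sound Γ P (T.seq T') R' := by
  refine sound_generate ?_ ?_
  · rintro D σ hP t (ht | ⟨t₁, ht₁, t₂, ht₂, _, rfl⟩)
    · exact (h D σ hP).1 t ht
    · exact ((h D σ hP).2 t₁ ht₁).append fun D' σ' hr => (h' D' σ' hr).1 t₂ ht₂
  · rintro D σ hP t ⟨t₁, ht₁, t₂, ht₂, _, rfl⟩
    exact ((h D σ hP).2 t₁ ht₁).append fun D' σ' hr => (h' D' σ' hr).2 t₂ ht₂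

theorem Sound.union {T T' : TransSys Var Lock} (h : Sound Γ P T R) (h' : Sound Γ P T' R) :
    Sound Γ P (T.union T') R := by
  refine sound_generate ?_ ?_
  · rintro D σ hP t (ht | ht)
    exacts [(h D σ hP).1 t ht, (h' D σ hP).1 t ht]
  · rintro D σ hP t (ht | ht)
    exacts [(h D σ hP).2 t ht, (h' D σ hP).2 t ht]

/-- A test on the first transition of a sequence bears on its first part, as long as the latter
makes a transition before it returns. -/
theorem Sound.when_seq {T T' : TransSys Var Lock} {B : BExp Var} {b : Bool}
    (hT : ∀ t ∈ T.ret, t.steps ≠ []) (h : Sound Γ P ((T.when B b).seq T') R) :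
    Sound Γ P ((T.seq T').when B b) R := by
  -- The guard of a composite trace is that of its first part.
  have guard : ∀ t₁ ∈ T.ret, ∀ t₂ : Trace Var Lock,
      (∀ st ∈ (t₁.comp t₂).steps.head?, B.eval st.pre.mem = some b) →
      t₁ ∈ (T.when B b).ret := by
    refine fun t₁ ht₁ t₂ hB => ⟨ht₁, fun st hst => hB st ?_⟩
    obtain ⟨a, l, e⟩ := List.exists_cons_of_ne_nil (hT t₁ ht₁)
    simp only [Trace.comp, e, List.cons_append, List.head?_cons] at hst ⊢
    exact hst
  have hret : ∀ t ∈ (T.seq T').ret, (∀ st ∈ t.steps.head?, B.eval st.pre.mem = some b) →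
      t ∈ ((T.when B b).seq T').ret := by
    rintro t ⟨t₁, ht₁, t₂, ht₂, e, rfl⟩ hB
    exact ⟨t₁, guard t₁ ht₁ t₂ hB, t₂, ht₂, e, rfl⟩
  refine sound_generate ?_ fun D σ hP t ht => (h D σ hP).2 t (hret t ht.1 ht.2)
  rintro D σ hP t ⟨⟨t', ht', hi⟩, hB⟩
  by_cases hnil : t.steps = []
  · rw [hnil]; trivial
  have hB' : ∀ st ∈ t'.steps.head?, B.eval st.pre.mem = some b := by
    obtain ⟨a, l, e⟩ := List.exists_cons_of_ne_nil hnil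
    obtain ⟨_, rest, e', _⟩ := hi
    rw [e, List.cons_append] at e'
    rw [e']
    rw [e] at hB
    exact hB
  rcases ht' with (ht' | ⟨t₁, ht₁, t₂, ht₂, e, rfl⟩) | ht'
  · exact ((h D σ hP).1 t' ⟨t', Or.inl (Or.inl
      ⟨t', Or.inl ⟨ht', hB'⟩, Trace.Initial.refl t'⟩), Trace.Initial.refl t'⟩).of_initial hi
  · exact ((h D σ hP).1 _ ⟨_, Or.inl (Or.inr ⟨t₁, guard t₁ ht₁ t₂ hB', t₂, ht₂, e, rfl⟩),
      Trace.Initial.refl _⟩).of_initial hi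
  · exact ((h D σ hP).2 t' (hret t' ht' hB')).of_initial hi

theorem safe_singleton {st : CodeStep Var Lock} {D : Set Lock} {σ : LState Var Perm}
    (h : ∀ z : SState Var Lock Perm, z.code = σ → z.domC = D → z.combine = st.pre →
      z.Respects Γ → ∃ z', Answer Γ st z z' ∧ R z'.domC z'.code) : Safe Γ R [st] D σ := h

theorem sound_ofInstr {m : Instr Var Lock}
    (h : ∀ (st : CodeStep Var Lock) (z : SState Var Lock Perm), st.instr = m →
      P z.domC z.code → z.combine = st.pre → z.Respects Γ →
        ∃ z', Answer Γ st z z' ∧ R z'.domC z'.code) :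
    Sound Γ P (TransSys.ofInstr m) R := by
  have key : ∀ D σ, P D σ → ∀ st : CodeStep Var Lock, st.instr = m → Safe Γ R [st] D σ := by
    refine fun D σ hP st hm => safe_singleton ?_
    rintro z rfl rfl hpre hz
    exact h st z hm hP hpre hz
  refine sound_generate ?_ ?_
  · rintro D σ hP t ⟨st, e, hm⟩
    rw [e]
    exact (key D σ hP st hm).mono fun _ _ _ => trivial
  · rintro D σ hP t ⟨st, e, hm, _⟩
    rw [e]
    exact key D σ hP st hm

theorem sound_ofInstr_when {m : Instr Var Lock} {B : BExp Var} {b : Bool}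
    (h : ∀ (st : CodeStep Var Lock) (z : SState Var Lock Perm), st.instr = m →
      B.eval st.pre.mem = some b → P z.domC z.code → z.combine = st.pre → z.Respects Γ →
        ∃ z', Answer Γ st z z' ∧ R z'.domC z'.code) :
    Sound Γ P ((TransSys.ofInstr m).when B b) R := by
  have key : ∀ D σ, P D σ → ∀ st : CodeStep Var Lock, st.instr = m →
      B.eval st.pre.mem = some b → Safe Γ R [st] D σ := by
    refine fun D σ hP st hm hB => safe_singleton ?_
    rintro z rfl rfl hpre hz
    exact h st z hm hB hP hpre hz
  refine sound_generate ?_ ?_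
  · rintro D σ hP t ⟨⟨t', ht', _, rest, e, _⟩, hB⟩
    obtain ⟨st, hst, hm⟩ : ∃ st : CodeStep Var Lock, t'.steps = [st] ∧ st.instr = m := by
      rcases ht' with ⟨st, hst, hm⟩ | ⟨st, hst, hm, _⟩ <;> exact ⟨st, hst, hm⟩
    rw [hst] at e
    rcases List.append_eq_singleton_iff.1 e.symm with ⟨e, _⟩ | ⟨e, _⟩
    · rw [e]; trivial
    · rw [e] at hB ⊢
      exact (key D σ hP st hm (hB st rfl)).mono fun _ _ _ => trivial
  · rintro D σ hP t ⟨⟨st, e, hm, _⟩, hB⟩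
    rw [e] at hB ⊢
    exact key D σ hP st hm (hB st rfl)

end Safety

/-! ### Instructions on the memory and on the locks -/

section Instructions

variable {Var : Type u} {Lock : Type v} {Perm : Type w} [PermMonoid Perm] [Fintype Lock]
  {Γ : Ctx Var Lock Perm} {st : CodeStep Var Lock} {z : SState Var Lock Perm}

theorem SState.combine_eval {z : SState Var Lock Perm} {s : MState Var Lock} (h : z.combine = s)
    {E : AExp Var} {n : ℤ} (hE : E.eval z.code.forget = some n) : E.eval s.mem = some n := by
  obtain ⟨ρ, hρ⟩ := z.code_star
  rw [← h, SState.combine_mem]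
  exact E.eval_mono (LState.star_forget_mono hρ) hE

theorem SState.combine_cell {z : SState Var Lock Perm} {s : MState Var Lock} (h : z.combine = s)
    {a : Var ⊕ ℕ} {n : ℤ} {p : Perm} (ha : z.code a = some (n, p)) : s.mem a = some n := by
  obtain ⟨ρ, hρ⟩ := z.code_star
  rw [← h, SState.combine_mem]
  exact LState.star_forget_mono hρ a n (by simp [LState.forget_apply, ha])

theorem SState.combine_evalB {z : SState Var Lock Perm} {s : MState Var Lock} (h : z.combine = s)
    {B : BExp Var} (hB : Assertion.defined B z.code) : B.eval s.mem = B.eval z.code.forget := by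
  obtain ⟨ρ, hρ⟩ := z.code_star
  obtain ⟨b, hb⟩ := BExp.exists_eval (μ := z.code.forget) B fun x hx => by
    simpa [LState.forget_apply] using hB x hx
  rw [hb, ← h, SState.combine_mem]
  exact B.eval_mono (LState.star_forget_mono hρ) hb

/-- The Code can write a cell that it owns with permission `top`. -/
theorem exists_answer_put {a : Var ⊕ ℕ} {n k : ℤ} (hpre : z.combine = st.pre) (hz : z.Respects Γ)
    (hl : st.instr.locksTaken = ∅) (hl' : st.instr.locksReleased = ∅)
    (ha : z.code a = some (k, PermMonoid.top)) (hs : Returns st.pre st.instr st.post)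
    (hpost : st.post = ⟨st.pre.mem.put a (some n), st.pre.locks⟩) :
    ∃ z' : SState Var Lock Perm, Answer Γ st z z' ∧ z'.domC = z.domC ∧
      z'.code = z.code.put a (some (n, PermMonoid.top)) := by
  have ht := z.some_total
  rw [mul_assoc] at ht
  obtain ⟨_, ρ, e, hρ, hstar⟩ := LState.exists_of_mul_eq_some ht
  cases e
  have ht' : some (z.code.put a (some (n, PermMonoid.top))) * (∏ r, (z.res r).logical) *
      some z.frame = some (z.total.put a (some (n, PermMonoid.top))) := by
    rw [mul_assoc, hρ]
    exact LState.star_put hstar ha n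
  have hcomb : (SState.ofProd _ _ _ _ ht').combine = st.post := by
    rw [hpost, ← hpre]
    refine MState.ext ?_ rfl
    rw [SState.combine_mem, SState.ofProd_total, LState.forget_put]
    rfl
  refine ⟨SState.ofProd _ _ _ _ ht', ⟨⟨rfl, ?_, fun _ _ => rfl, ?_, ?_⟩, hcomb, hz, fun _ _ => rfl,
    ?_⟩, rfl, rfl⟩
  · rw [hcomb, hpre]; exact hs
  · simp [hl]
  · simp [hl']
  · rw [SState.ofProd_total, LState.perms_put _ (LState.star_top_right hstar ha).2]

theorem answer_nop (hpre : z.combine = st.pre) (hz : z.Respects Γ) (hi : st.instr = .nop) :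
    Answer Γ st z z := by
  obtain ⟨s, m, s', hs⟩ := st
  subst hi
  obtain rfl : s = s' := by rcases hs with hs | hs <;> cases hs; rfl
  refine ⟨⟨rfl, ?_, fun _ _ => rfl, ?_, ?_⟩, hpre, hz, fun _ _ => rfl, rfl⟩
  · exact .nop
  · simp [Instr.locksTaken]
  · simp [Instr.locksReleased]

variable [DecidableEq Lock]

/-- Acquiring an available resource of the context, the Code receives its invariant. -/
theorem exists_answer_acquire {r : Lock} {J : Assertion Var Perm} (hpre : z.combine = st.pre)
    (hz : z.Respects Γ) (hi : st.instr = .acquire r) (hJ : Γ r = some J) :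
    ∃ (z' : SState Var Lock Perm) (j : LState Var Perm), Answer Γ st z z' ∧ J j ∧
      z.code.star j = some z'.code ∧ r ∉ z.domC ∧ z'.domC = insert r z.domC := by
  obtain ⟨s, m, s', hs⟩ := st
  subst hi
  rcases hs with hs | hs
  swap
  · cases hs
  obtain ⟨μ, L, hr⟩ : ∃ μ L, r ∉ L ∧ s = ⟨μ, L⟩ ∧ s' = ⟨μ, insert r L⟩ := by
    cases hs with | acquire h => exact ⟨_, _, h, rfl, rfl⟩
  obtain ⟨hrL, rfl, rfl⟩ := hr
  have hμ : z.total.forget = μ := congrArg MState.mem hpre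
  have hL : z.domC ∪ z.domF = L := congrArg MState.locks hpre
  obtain ⟨j, hj⟩ := z.exists_avail (r := r) (by rw [hpre]; exact hrL)
  have ht := z.some_total
  rw [SState.prod_eq_mul_erase _ r, hj, ← mul_assoc] at ht
  obtain ⟨κ, hκ⟩ : ∃ κ, some z.code * (Status.avail j).logical = some κ := by
    obtain ⟨_, _, h, _⟩ := LState.exists_of_mul_eq_some ht
    obtain ⟨κ, _, h, _⟩ := LState.exists_of_mul_eq_some h
    exact ⟨κ, h⟩
  have ht' : some κ * (∏ r', (Function.update z.res r .code r').logical) * some z.frame =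
      some z.total := by
    rw [SState.prod_update, ← ht, hκ]
    change _ * (1 * _) * _ = _
    rw [one_mul]
  have hdom : (SState.ofProd _ _ _ _ ht').domC = insert r z.domC := by
    ext r'
    by_cases h : r' = r
    · subst h; simp [SState.domC, SState.ofProd]
    · simp [SState.domC, SState.ofProd, h]
  have hdomF : (SState.ofProd _ _ _ _ ht').domF = z.domF := by
    ext r'
    by_cases h : r' = r
    · subst h; simp [SState.domF, SState.ofProd, hj]
    · simp [SState.domF, SState.ofProd, h]
  have hcomb : (SState.ofProd _ _ _ _ ht').combine = ⟨μ, insert r L⟩ := by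
    refine MState.ext ?_ ?_
    · rw [SState.combine_mem, SState.ofProd_total, hμ]
    · rw [SState.combine_locks, hdom, hdomF, ← hL, Set.insert_union]
  refine ⟨SState.ofProd _ _ _ _ ht', j, ⟨⟨rfl, ?_, ?_, ?_, ?_⟩, hcomb, ?_, ?_, ?_⟩,
    hz r j hj J hJ, hκ, ?_, hdom⟩
  · rw [hcomb, hpre]; exact hs
  · intro r' hr'
    have : r' ≠ r := by rintro rfl; exact hr' (Or.inl rfl)
    exact (Function.update_of_ne this _ _).symm
  · intro r' hr'
    rw [show r' = r from hr']
    exact ⟨⟨j, hj⟩, Function.update_self _ _ _⟩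
  · rintro r' ⟨⟩
  · intro r' σ h' J' hJ'
    by_cases h : r' = r
    · subst h; simp [SState.ofProd] at h'
    · exact hz r' σ (by simpa [SState.ofProd, h] using h') J' hJ'
  · intro r' hr'
    have : r' ≠ r := by rintro rfl; simp [hJ] at hr'
    exact Function.update_of_ne this _ _
  · rw [SState.ofProd_total]
  · simp [SState.domC, hj]

/-- Releasing a resource of the context, the Code gives up its invariant. -/
theorem exists_answer_release {r : Lock} {J : Assertion Var Perm} {q j : LState Var Perm}
    (hpre : z.combine = st.pre) (hz : z.Respects Γ) (hi : st.instr = .release r)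
    (hJ : Γ r = some J) (hr : r ∈ z.domC) (hq : q.star j = some z.code) (hj : J j) :
    ∃ z' : SState Var Lock Perm, Answer Γ st z z' ∧ z'.code = q ∧ z'.domC = z.domC \ {r} := by
  obtain ⟨s, m, s', hs⟩ := st
  subst hi
  rcases hs with hs | hs
  swap
  · cases hs
  obtain ⟨μ, L, hrL, rfl, rfl⟩ : ∃ μ L, r ∉ L ∧ s = ⟨μ, insert r L⟩ ∧ s' = ⟨μ, L⟩ := by
    cases hs with | release h => exact ⟨_, _, h, rfl, rfl⟩
  have hμ : z.total.forget = μ := congrArg MState.mem hpre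
  have hL : z.domC ∪ z.domF = insert r L := congrArg MState.locks hpre
  have hcode : z.res r = .code := hr
  have ht := z.some_total
  have ht' : some q * (∏ r', (Function.update z.res r (.avail j) r').logical) * some z.frame =
      some z.total := by
    rw [SState.prod_eq_mul_erase _ r, hcode] at ht
    rw [SState.prod_update, ← ht, ← hq, ← LState.some_mul_some, ← mul_assoc (some q)]
    change _ = _ * (1 * _) * _
    rw [one_mul]; rfl
  have hdom : (SState.ofProd _ _ _ _ ht').domC = z.domC \ {r} := by
    ext r'
    by_cases h : r' = r
    · subst h; simp [SState.domC, SState.ofProd]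
    · simp [SState.domC, SState.ofProd, h]
  have hcomb : (SState.ofProd _ _ _ _ ht').combine = ⟨μ, L⟩ := by
    refine MState.ext ?_ ?_
    · rw [SState.combine_mem, SState.ofProd_total, hμ]
    · ext r'
      have hL' : r' ∈ z.combine.locks ↔ r' ∈ insert r L := by rw [hpre]
      rw [SState.mem_locks] at hL' ⊢
      by_cases h : r' = r
      · subst h; simp [SState.ofProd, hrL]
      · simpa [SState.ofProd, h] using hL'
  refine ⟨SState.ofProd _ _ _ _ ht', ⟨⟨rfl, ?_, ?_, ?_, ?_⟩, hcomb, ?_, ?_, ?_⟩, rfl, hdom⟩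
  · rw [hcomb, hpre]; exact hs
  · intro r' hr'
    have : r' ≠ r := by rintro rfl; exact hr' (Or.inr rfl)
    exact (Function.update_of_ne this _ _).symm
  · rintro r' ⟨⟩
  · intro r' hr'
    rw [show r' = r from hr']
    exact ⟨hr, j, Function.update_self _ _ _⟩
  · intro r' σ h' J' hJ'
    by_cases h : r' = r
    · subst h
      simp only [SState.ofProd, Function.update_self, Status.avail.injEq] at h'
      cases hJ.symm.trans hJ'
      rwa [← h']
    · exact hz r' σ (by simpa [SState.ofProd, h] using h') J' hJ'
  · intro r' hr'
    have : r' ≠ r := by rintro rfl; simp [hJ] at hr'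
    exact Function.update_of_ne this _ _
  · rw [SState.ofProd_total]

end Instructions

/-! ### Conjunction -/

section Conjunction

variable {Var : Type u} {Lock : Type v} {Perm : Type w} [PermMonoid Perm] [Fintype Lock]
  [DecidableEq Lock] {Γ : Ctx Var Lock Perm} {st : CodeStep Var Lock}
  {z z₁ z₂ : SState Var Lock Perm} {R R' : Set Lock → LState Var Perm → Prop}

/-- In a precise context Eve has at most one answer: the total state is determined by the trace, and
precision determines the state given up with a released resource. -/
theorem Answer.unique (hΓ : Γ.Precise) (h₁ : Answer Γ st z z₁) (h₂ : Answer Γ st z z₂) :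
    z₁ = z₂ := by
  obtain ⟨⟨hf₁, -, hk₁, ht₁, hr₁⟩, hc₁, hi₁, ho₁, hp₁⟩ := h₁
  obtain ⟨⟨hf₂, -, hk₂, ht₂, hr₂⟩, hc₂, hi₂, ho₂, hp₂⟩ := h₂
  have htot : z₁.total = z₂.total :=
    LState.ext_forget_perms (congrArg MState.mem (hc₁.trans hc₂.symm)) (hp₁.trans hp₂.symm)
  have hres : z₁.res = z₂.res := by
    funext r
    by_cases hr : r ∈ st.instr.locksReleased
    · obtain ⟨-, σ₁, e₁⟩ := hr₁ r hr
      obtain ⟨-, σ₂, e₂⟩ := hr₂ r hr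
      rcases hJ : Γ r with _ | J
      · rw [ho₁ r hJ, ho₂ r hJ]
      · have := hΓ r J hJ z₁.total σ₁ σ₂ ⟨SState.avail_star e₁, hi₁ r σ₁ e₁ J hJ⟩
          ⟨htot ▸ SState.avail_star e₂, hi₂ r σ₂ e₂ J hJ⟩
        rw [e₁, e₂, this]
    · by_cases hr' : r ∈ st.instr.locksTaken
      · exact (ht₁ r hr').2.trans (ht₂ r hr').2.symm
      · have : r ∉ st.instr.locksTaken ∪ st.instr.locksReleased := fun h => h.elim hr' hr
        exact (hk₁ r this).symm.trans (hk₂ r this)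
  have hframe := hf₁.trans hf₂.symm
  refine SState.ext ?_ hres hframe
  have e₁ := z₁.some_total
  have e₂ := z₂.some_total
  rw [mul_assoc] at e₁ e₂
  rw [← htot, ← hres, ← hframe] at e₂
  exact LState.mul_cancel e₁ e₂

theorem Safe.and (hΓ : Γ.Precise) :
    ∀ {l : List (CodeStep Var Lock)} {D : Set Lock} {σ : LState Var Perm},
      Safe Γ R l D σ → Safe Γ R' l D σ → Safe Γ (fun D σ => R D σ ∧ R' D σ) l D σ
  | [], _, _, h, h' => ⟨h, h'⟩
  | _ :: _, _, _, h, h' => fun z h₁ h₂ h₃ h₄ => by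
    obtain ⟨z', ha, hs⟩ := h z h₁ h₂ h₃ h₄
    obtain ⟨z'', ha', hs'⟩ := h' z h₁ h₂ h₃ h₄
    cases ha.unique hΓ ha'
    exact ⟨z', ha, hs.and hΓ hs'⟩

end Conjunction

/-! ### Parallel composition -/

section Parallel

variable {Var : Type u} {Lock : Type v} {Perm : Type w} [PermMonoid Perm] [Fintype Lock]
  {Γ : Ctx Var Lock Perm} {R₁ R₂ : Set Lock → LState Var Perm → Prop}

open Classical in
/-- A Code made of two parts can make the moves of the first: from the point of view of this part,
the state `σ₂` and the locks `D₂` of the second belong to the Frame. -/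
theorem exists_answer_of_part {st : CodeStep Var Lock} {z : SState Var Lock Perm}
    {σ₁ σ₂ : LState Var Perm} {D₁ D₂ : Set Lock} {K : Set Lock → LState Var Perm → Prop}
    (hσ : σ₁.star σ₂ = some z.code) (hD : z.domC = D₁ ∪ D₂) (hdisj : Disjoint D₁ D₂)
    (hpre : z.combine = st.pre) (hz : z.Respects Γ)
    (H : ∀ z₁ : SState Var Lock Perm, z₁.code = σ₁ → z₁.domC = D₁ → z₁.combine = st.pre →
      z₁.Respects Γ → ∃ z₁', Answer Γ st z₁ z₁' ∧ K z₁'.domC z₁'.code) :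
    ∃ z' : SState Var Lock Perm, Answer Γ st z z' ∧ ∃ D₁' σ₁', z'.domC = D₁' ∪ D₂ ∧
      Disjoint D₁' D₂ ∧ σ₁'.star σ₂ = some z'.code ∧ K D₁' σ₁' := by
  have hD₂ : ∀ r ∈ D₂, z.res r = .code := fun r hr => by
    have : r ∈ z.domC := hD ▸ Or.inr hr
    exact this
  have hD₁ : ∀ r, r ∈ D₁ ↔ r ∉ D₂ ∧ z.res r = .code := fun r => by
    have : r ∈ z.domC ↔ r ∈ D₁ ∪ D₂ := by rw [hD]
    change z.res r = .code ↔ _ at this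
    rw [this]
    constructor
    · exact fun h => ⟨fun h' => Set.disjoint_left.1 hdisj h h', Or.inl h⟩
    · exact fun h => h.2.resolve_right h.1
  have ht := z.some_total
  rw [← hσ, ← LState.some_mul_some, mul_right_comm (some σ₁), mul_assoc] at ht
  obtain ⟨-, φ, -, hφ, -⟩ := LState.exists_of_mul_eq_some ht
  let res : Lock → Status Var Perm := fun r => if r ∈ D₂ then .frame else z.res r
  have hlog : ∏ r, (res r).logical = ∏ r, (z.res r).logical := by
    refine Finset.prod_congr rfl fun r _ => ?_
    by_cases h : r ∈ D₂
    · simp only [res, h, if_true, hD₂ r h]; rfl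
    · simp only [res, h, if_false]
  have ht₁ : some σ₁ * (∏ r, (res r).logical) * some φ = some z.total := by
    rw [hlog, ← hφ, ht]
  have hres : ∀ r, (SState.ofProd _ _ _ _ ht₁).res r = if r ∈ D₂ then .frame else z.res r :=
    fun _ => rfl
  obtain ⟨z₁', ⟨⟨hf, hret, hkeep, htake, hrel⟩, hcomb, hresp, hout, hperm⟩, hK⟩ :=
    H (SState.ofProd _ _ _ _ ht₁) rfl (by
      ext r
      change (if r ∈ D₂ then Status.frame else z.res r) = .code ↔ _
      rw [hD₁]
      split_ifs with h <;> simp [h]) (by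
      rw [← hpre]
      refine MState.ext ?_ ?_
      · rw [SState.combine_mem, SState.ofProd_total, SState.combine_mem]
      · ext r
        rw [SState.mem_locks, SState.mem_locks, hres]
        split_ifs with h <;> simp [h, hD₂]) (by
      intro r σ hr J hJ
      rw [hres] at hr
      split_ifs at hr
      exact hz r σ hr J hJ)
  -- The locks of the second part are not touched.
  have hD₂' : ∀ r ∈ D₂, z₁'.res r = .frame := by
    intro r hr
    have hr' := hres r
    rw [if_pos hr] at hr'
    rw [← hkeep r, hr']
    rintro (h | h)
    · obtain ⟨⟨σ, e⟩, -⟩ := htake r h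
      rw [hr'] at e; cases e
    · have e : _ = Status.code := (hrel r h).1
      rw [hr'] at e; cases e
  have hcombz : (SState.ofProd _ _ _ _ ht₁).combine = z.combine := by
    refine MState.ext ?_ ?_
    · rw [SState.combine_mem, SState.ofProd_total, SState.combine_mem]
    · ext r
      rw [SState.mem_locks, SState.mem_locks, hres]
      split_ifs with h <;> simp [h, hD₂]
  have ht₁' := z₁'.some_total
  rw [show z₁'.frame = φ from hf, ← hφ, ← mul_assoc, mul_right_comm (some z₁'.code)] at ht₁'
  obtain ⟨κ, hκ⟩ : ∃ κ, some z₁'.code * some σ₂ = some κ := by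
    obtain ⟨_, _, h, _⟩ := LState.exists_of_mul_eq_some ht₁'
    obtain ⟨κ, _, h, _⟩ := LState.exists_of_mul_eq_some h
    exact ⟨κ, h⟩
  let res' : Lock → Status Var Perm := fun r => if r ∈ D₂ then .code else z₁'.res r
  have hlog' : ∏ r, (res' r).logical = ∏ r, (z₁'.res r).logical := by
    refine Finset.prod_congr rfl fun r _ => ?_
    by_cases h : r ∈ D₂
    · simp only [res', h, if_true, hD₂' r h]; rfl
    · simp only [res', h, if_false]
  have ht' : some κ * (∏ r, (res' r).logical) * some z.frame = some z₁'.total := by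
    rw [hlog', ← hκ, ht₁']
  have hres' : ∀ r, (SState.ofProd _ _ _ _ ht').res r = if r ∈ D₂ then .code else z₁'.res r :=
    fun _ => rfl
  have hcomb' : (SState.ofProd _ _ _ _ ht').combine = z₁'.combine := by
    refine MState.ext ?_ ?_
    · rw [SState.combine_mem, SState.ofProd_total, SState.combine_mem]
    · ext r
      rw [SState.mem_locks, SState.mem_locks, hres']
      split_ifs with h <;> simp [h, hD₂']
  have hsame : ∀ r, z₁'.res r = (SState.ofProd _ _ _ _ ht₁).res r →
      (SState.ofProd _ _ _ _ ht').res r = z.res r := by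
    intro r h
    rw [hres']
    rw [hres] at h
    split_ifs with hr
    · exact (hD₂ r hr).symm
    · rw [h, if_neg hr]
  refine ⟨SState.ofProd _ _ _ _ ht', ⟨⟨rfl, ?_, ?_, ?_, ?_⟩, hcomb'.trans hcomb, ?_, ?_, ?_⟩,
    z₁'.domC, z₁'.code, ?_, ?_, hκ, hK⟩
  · rw [hcomb', ← hcombz]; exact hret
  · exact fun r hr => (hsame r (hkeep r hr).symm).symm
  · intro r hr
    obtain ⟨⟨σ, e⟩, h⟩ := htake r hr
    rw [hres] at e
    split_ifs at e with h₂
    refine ⟨⟨σ, e⟩, ?_⟩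
    change (if r ∈ D₂ then Status.code else z₁'.res r) = .code
    rw [if_neg h₂]; exact h
  · intro r hr
    obtain ⟨e, σ, h⟩ := hrel r hr
    change (if r ∈ D₂ then Status.frame else z.res r) = .code at e
    split_ifs at e with h₂
    exact ⟨e, σ, by rw [hres', if_neg h₂, h]⟩
  · intro r σ hr J hJ
    rw [hres'] at hr
    split_ifs at hr
    exact hresp r σ hr J hJ
  · exact fun r hr => hsame r (hout r hr)
  · rw [SState.ofProd_total, hperm, SState.ofProd_total]
  · ext r
    change (if r ∈ D₂ then Status.code else z₁'.res r) = .code ↔ z₁'.res r = .code ∨ r ∈ D₂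
    split_ifs with h <;> simp [h]
  · refine Set.disjoint_left.2 fun r hr h => ?_
    have : z₁'.res r = .code := hr
    rw [hD₂' r h] at this
    cases this

/-- Two threads that own disjoint states and locks are safe together along any shuffle. -/
theorem Safe.par {l₁ l₂ l : List (CodeStep Var Lock)} (hl : Shuffle l₁ l₂ l) :
    ∀ {D₁ D₂ D : Set Lock} {σ₁ σ₂ σ : LState Var Perm}, D = D₁ ∪ D₂ → Disjoint D₁ D₂ →
      σ₁.star σ₂ = some σ → Safe Γ R₁ l₁ D₁ σ₁ → Safe Γ R₂ l₂ D₂ σ₂ →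
      Safe Γ (fun D σ => ∃ D₁ D₂ σ₁ σ₂, D = D₁ ∪ D₂ ∧ σ₁.star σ₂ = some σ ∧
        R₁ D₁ σ₁ ∧ R₂ D₂ σ₂) l D σ := by
  induction hl with
  | nil => exact fun hD _ hσ h₁ h₂ => ⟨_, _, _, _, hD, hσ, h₁, h₂⟩
  | left _ ih =>
    rintro D₁ D₂ D σ₁ σ₂ σ hD hdisj hσ h₁ h₂ z rfl hzD hpre hz
    obtain ⟨z', ha, D₁', σ₁', hD', hdisj', hσ', hK⟩ :=
      exists_answer_of_part hσ (hzD.trans hD) hdisj hpre hz h₁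
    exact ⟨z', ha, ih hD' hdisj' hσ' hK h₂⟩
  | right _ ih =>
    rintro D₁ D₂ D σ₁ σ₂ σ hD hdisj hσ h₁ h₂ z rfl hzD hpre hz
    rw [LState.star_comm] at hσ
    obtain ⟨z', ha, D₂', σ₂', hD', hdisj', hσ', hK⟩ :=
      exists_answer_of_part hσ (hzD.trans (hD.trans (Set.union_comm _ _))) hdisj.symm hpre hz h₂
    rw [LState.star_comm] at hσ'
    exact ⟨z', ha, ih (hD'.trans (Set.union_comm _ _)) hdisj'.symm hσ' h₁ hK⟩

theorem Shuffle.nil_right {α : Type u} : ∀ l : List α, Shuffle l [] l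
  | [] => .nil
  | _ :: l => .left (Shuffle.nil_right l)

end Parallel

/-! ### Resource declarations -/

section Hiding

variable {Var : Type u} {Lock : Type v}

theorem Returns.hide (r : Lock) {s s' : MState Var Lock} {m : Instr Var Lock}
    (h : Returns s m s') : Returns (s.hide r) (m.hide r) (s'.hide r) := by
  cases h with
  | assign h => exact .assign h
  | load h h' => exact .load h h'
  | store h h' => exact .store h h'
  | nop => exact .nop
  | alloc h h' => exact .alloc h h'
  | dispose h => exact .dispose h
  | @acquire μ L r' h =>
    by_cases hr : r' = r
    · subst hr
      simpa [MState.hide, Instr.hide] using Returns.nop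
    · simp only [MState.hide, Instr.hide, hr, if_false,
        Set.insert_sdiff_of_notMem L (show r' ∉ ({r} : Set Lock) from hr)]
      exact .acquire fun h' => h h'.1
  | @release μ L r' h =>
    by_cases hr : r' = r
    · subst hr
      simpa [MState.hide, Instr.hide] using Returns.nop
    · simp only [MState.hide, Instr.hide, hr, if_false,
        Set.insert_sdiff_of_notMem L (show r' ∉ ({r} : Set Lock) from hr)]
      exact .release fun h' => h h'.1

theorem Instr.locksTaken_hide (r : Lock) (m : Instr Var Lock) :
    (m.hide r).locksTaken = m.locksTaken \ {r} := by
  cases m with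
  | acquire r' =>
    by_cases hr : r' = r
    · simp [Instr.hide, Instr.locksTaken, hr]
    · simp [Instr.hide, Instr.locksTaken, hr, Ne.symm hr]
  | release r' =>
    by_cases hr : r' = r <;> simp [Instr.hide, Instr.locksTaken, hr]
  | _ => simp [Instr.hide, Instr.locksTaken]

theorem Instr.locksReleased_hide (r : Lock) (m : Instr Var Lock) :
    (m.hide r).locksReleased = m.locksReleased \ {r} := by
  cases m with
  | release r' =>
    by_cases hr : r' = r
    · simp [Instr.hide, Instr.locksReleased, hr]
    · simp [Instr.hide, Instr.locksReleased, hr, Ne.symm hr]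
  | acquire r' =>
    by_cases hr : r' = r <;> simp [Instr.hide, Instr.locksReleased, hr]
  | _ => simp [Instr.hide, Instr.locksReleased]

variable {Perm : Type w} [PermMonoid Perm] [Fintype Lock]
  {Γ : Ctx Var Lock Perm}

/-- The Code that owns `σ` and `D` outside the scope of the declaration of `r` owns `κ` and `D'`
inside, where the resource `r` with invariant `J` is available with the rest of `σ` or locked by
the Code; `s` is the machine state inside. -/
def Hides (r : Lock) (J : Assertion Var Perm) (D : Set Lock) (σ : LState Var Perm) (D' : Set Lock)
    (κ : LState Var Perm) (s : MState Var Lock) : Prop :=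
  ∃ x : Status Var Perm, some κ * x.logical = some σ ∧ (∀ j, x = .avail j → J j) ∧ x ≠ .frame ∧
    (r ∈ D' ↔ x = .code) ∧ (r ∈ s.locks ↔ x = .code) ∧ r ∉ D ∧ ∀ r' ≠ r, r' ∈ D' ↔ r' ∈ D

variable [DecidableEq Lock]

/-- The Code transition of `resource r do C` that hides the transition `st` of `C`. The logical state
that `r` may have outside the scope of the declaration belongs to the Frame inside. -/
theorem exists_answer_hide {r : Lock} {J : Assertion Var Perm} (hΓ : Γ r = none)
    {st : CodeStep Var Lock} {z : SState Var Lock Perm} {D' : Set Lock} {κ : LState Var Perm}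
    {K : Set Lock → LState Var Perm → Prop} (hh : Hides r J z.domC z.code D' κ st.pre)
    (hpre : z.combine = st.pre.hide r) (hz : z.Respects Γ)
    (H : ∀ z₁ : SState Var Lock Perm, z₁.code = κ → z₁.domC = D' → z₁.combine = st.pre →
      z₁.Respects (Function.update Γ r (some J)) →
      ∃ z₁', Answer (Function.update Γ r (some J)) st z₁ z₁' ∧ K z₁'.domC z₁'.code) :
    ∃ z' : SState Var Lock Perm, Answer Γ (st.hide r) z z' ∧
      ∃ D'' κ', Hides r J z'.domC z'.code D'' κ' st.post ∧ K D'' κ' := by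
  obtain ⟨x, hx, hxJ, hxF, hxD', hxs, hrD, hDD'⟩ := hh
  obtain ⟨ς, hς⟩ : ∃ ς, z.res r = .avail ς := z.exists_avail (by
    rw [hpre]; simp [MState.hide])
  have hlocks : ∀ r' ≠ r, r' ∈ z.combine.locks ↔ r' ∈ st.pre.locks := fun r' hr' => by
    rw [hpre]; simp [MState.hide, hr']
  have ht := z.some_total
  rw [SState.prod_eq_mul_erase _ r, hς, ← hx,
    show ∀ a b c d e : Option (LState Var Perm), a * b * (c * d) * e = a * (b * d) * (c * e) by
      intros; ac_rfl] at ht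
  obtain ⟨-, φ, -, hφ, -⟩ := LState.exists_of_mul_eq_some ht
  rw [hφ, ← SState.prod_update] at ht
  have hres : ∀ r' ≠ r, (SState.ofProd _ _ _ _ ht).res r' = z.res r' := fun r' hr' =>
    Function.update_of_ne hr' _ _
  have hresr : (SState.ofProd _ _ _ _ ht).res r = x := Function.update_self _ _ _
  have hcomb : (SState.ofProd _ _ _ _ ht).combine = st.pre := by
    refine MState.ext ?_ ?_
    · rw [SState.combine_mem, SState.ofProd_total]
      exact congrArg MState.mem hpre
    · ext r'
      by_cases h : r' = r
      · subst h
        rw [SState.mem_locks, hresr, hxs]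
        cases x <;> simp_all
      · rw [← hlocks r' h, SState.mem_locks, SState.mem_locks, hres r' h]
  obtain ⟨z₁', ⟨⟨hf, hret, hkeep, htake, hrel⟩, hcomb', hresp, hout, hperm⟩, hK⟩ :=
    H (SState.ofProd _ _ _ _ ht) rfl (by
      ext r'
      change (SState.ofProd _ _ _ _ ht).res r' = .code ↔ _
      by_cases h : r' = r
      · subst h; rw [hresr, hxD']
      · rw [hres r' h, hDD' r' h]; rfl) hcomb (by
      intro r' σ hr' J' hJ'
      by_cases h : r' = r
      · subst h
        rw [Function.update_self] at hJ'
        cases hJ'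
        exact hxJ σ (hresr.symm.trans hr')
      · rw [Function.update_of_ne h] at hJ'
        exact hz r' σ ((hres r' h).symm.trans hr') J' hJ')
  have ht' := z₁'.some_total
  rw [show z₁'.frame = φ from hf, ← hφ, SState.prod_eq_mul_erase _ r,
    show ∀ a b c d e : Option (LState Var Perm), a * (b * d) * (c * e) = a * b * (c * d) * e by
      intros; ac_rfl] at ht'
  obtain ⟨κ', hκ'⟩ : ∃ κ', some z₁'.code * (z₁'.res r).logical = some κ' := by
    obtain ⟨_, _, h, _⟩ := LState.exists_of_mul_eq_some ht'
    obtain ⟨κ, _, h, _⟩ := LState.exists_of_mul_eq_some h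
    exact ⟨κ, h⟩
  rw [hκ', ← SState.prod_update] at ht'
  have hres' : ∀ r' ≠ r, (SState.ofProd _ _ _ _ ht').res r' = z₁'.res r' := fun r' hr' =>
    Function.update_of_ne hr' _ _
  have hresr' : (SState.ofProd _ _ _ _ ht').res r = .avail ς := Function.update_self _ _ _
  have hcombz : (SState.ofProd _ _ _ _ ht').combine = st.post.hide r := by
    rw [← hcomb']
    refine MState.ext ?_ ?_
    · rw [SState.combine_mem, SState.ofProd_total]
      rfl
    · ext r'
      by_cases h : r' = r
      · subst h
        rw [SState.mem_locks, hresr']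
        simp [MState.hide]
      · have : r' ∈ (z₁'.combine.hide r).locks ↔ r' ∈ z₁'.combine.locks := by
          simp [MState.hide, h]
        rw [this, SState.mem_locks, SState.mem_locks, hres' r' h]
  have hx'F : z₁'.res r ≠ .frame := by
    intro h
    by_cases h₁ : r ∈ st.instr.locksTaken ∪ st.instr.locksReleased
    · rcases h₁ with h₁ | h₁
      · have : z₁'.res r = .code := (htake r h₁).2
        simp [h] at this
      · obtain ⟨-, σ, hσ⟩ := hrel r h₁
        simp [h] at hσ
    · rw [← hkeep r h₁, hresr] at h
      exact hxF h
  have hsame : ∀ r', (r' ≠ r → z₁'.res r' = (SState.ofProd _ _ _ _ ht).res r') →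
      (SState.ofProd _ _ _ _ ht').res r' = z.res r' := by
    intro r' h
    by_cases hr : r' = r
    · subst hr; rw [hresr', hς]
    · rw [hres' r' hr, h hr, hres r' hr]
  refine ⟨SState.ofProd _ _ _ _ ht', ⟨⟨rfl, ?_, ?_, ?_, ?_⟩, hcombz, ?_, ?_, ?_⟩,
    z₁'.domC, z₁'.code, ⟨z₁'.res r, hκ', ?_, hx'F, Iff.rfl, ?_, ?_, ?_⟩, hK⟩
  · rw [hcombz, hpre]
    rw [hcomb, hcomb'] at hret
    exact hret.hide r
  · intro r' hr'
    refine (hsame r' fun hr => (hkeep r' fun h => hr' ?_).symm).symm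
    change r' ∈ (st.instr.hide r).locksTaken ∪ (st.instr.hide r).locksReleased
    rw [Instr.locksTaken_hide, Instr.locksReleased_hide]
    exact h.imp (fun h => ⟨h, hr⟩) fun h => ⟨h, hr⟩
  · intro r' hr'
    rw [show (st.hide r).instr = st.instr.hide r from rfl, Instr.locksTaken_hide] at hr'
    obtain ⟨hr', hr⟩ := hr'
    obtain ⟨⟨σ, e⟩, h⟩ := htake r' hr'
    exact ⟨⟨σ, (hres r' hr).symm.trans e⟩, (hres' r' hr).trans h⟩
  · intro r' hr'
    rw [show (st.hide r).instr = st.instr.hide r from rfl, Instr.locksReleased_hide] at hr'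
    obtain ⟨hr', hr⟩ := hr'
    obtain ⟨e, σ, h⟩ := hrel r' hr'
    exact ⟨(hres r' hr).symm.trans e, σ, (hres' r' hr).trans h⟩
  · intro r' σ hr' J' hJ'
    by_cases h : r' = r
    · subst h; rw [hΓ] at hJ'; cases hJ'
    · exact hresp r' σ ((hres' r' h).symm.trans hr') J' (by rwa [Function.update_of_ne h])
  · exact fun r' hr' => hsame r' fun h => hout r' (by rwa [Function.update_of_ne h])
  · rw [SState.ofProd_total, hperm, SState.ofProd_total]
  · exact fun j hj => hresp r j hj J (Function.update_self _ _ _)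
  · rw [← hcomb', SState.mem_locks]
    cases hc : z₁'.res r <;> simp_all
  · intro h
    have : (SState.ofProd _ _ _ _ ht').res r = .code := h
    rw [hresr'] at this
    cases this
  · intro r' hr'
    change z₁'.res r' = .code ↔ (SState.ofProd _ _ _ _ ht').res r' = .code
    rw [hres' r' hr']

theorem Safe.hide {r : Lock} {J : Assertion Var Perm} (hΓ : Γ r = none)
    {R : Set Lock → LState Var Perm → Prop} {target : MState Var Lock} :
    ∀ {l : List (CodeStep Var Lock)} {s : MState Var Lock} {D D' : Set Lock}
      {σ κ : LState Var Perm}, EnvKeeps r s l target → Hides r J D σ D' κ s →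
      Safe (Function.update Γ r (some J)) R l D' κ →
      Safe Γ (fun D σ => ∃ D' κ s, Hides r J D σ D' κ s ∧ R D' κ) (l.map (CodeStep.hide r)) D σ
  | [], s, _, D', _, κ, _, hh, hs => ⟨D', κ, s, hh, hs⟩
  | st :: l, s, D, D', σ, κ, ⟨hk, hkl⟩, hh, hs => by
    rintro z rfl rfl hpre hz
    have hh' : Hides r J z.domC z.code D' κ st.pre := by
      obtain ⟨x, h₁, h₂, h₃, h₄, h₅, h₆⟩ := hh
      exact ⟨x, h₁, h₂, h₃, h₄, hk.symm.trans h₅, h₆⟩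
    obtain ⟨z', ha, D'', κ', hh'', hK⟩ := exists_answer_hide hΓ hh' hpre hz hs
    exact ⟨z', ha, Safe.hide hΓ hkl hh'' hK⟩

theorem Sound.hide {r : Lock} {J P Q : Assertion Var Perm} {T : TransSys Var Lock}
    (hΓ : Γ r = none)
    (h : ∀ D, Sound (Function.update Γ r (some J)) (Owning P D) T (Owning Q D)) (D : Set Lock) :
    Sound Γ (Owning (P.sep J) D) (T.hide r) (Owning (Q.sep J) D) := by
  have init : ∀ κ j σ : LState Var Perm, κ.star j = some σ → J j → r ∉ D →
      ∀ s : MState Var Lock, r ∉ s.locks → Hides r J D σ D κ s := fun κ j σ hσ hj hD s hs =>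
    ⟨.avail j, hσ, by rintro _ ⟨⟩; exact hj, by simp, by simp [hD], by simp [hs], hD,
      fun _ _ => Iff.rfl⟩
  -- Outside, the Code cannot own the resource at its first transition, where `r` is unlocked.
  have vacuous : ∀ {R : Set Lock → LState Var Perm → Prop} {st : CodeStep Var Lock}
      {l : List (CodeStep Var Lock)} {σ : LState Var Perm}, r ∈ D →
      Safe Γ R ((st :: l).map (CodeStep.hide r)) D σ := by
    rintro R st l σ hD z - rfl hpre -
    have : r ∈ z.combine.locks := Or.inl hD
    rw [hpre] at this
    exact absurd rfl this.2
  refine sound_generate ?_ ?_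
  · rintro D σ ⟨rfl, κ, j, hσ, hP, hj⟩ _ ⟨⟨s, l, s'⟩, ht, ⟨hs, hk⟩, rfl⟩
    rcases l with _ | ⟨st, l⟩
    · trivial
    by_cases hD : r ∈ D
    · exact vacuous hD
    · exact (((h D D κ ⟨rfl, hP⟩).1 _ ht).hide hΓ hk (init κ j σ hσ hj hD _ hs)).mono
        fun _ _ _ => trivial
  · rintro D σ ⟨rfl, κ, j, hσ, hP, hj⟩ _ ⟨⟨s, l, s'⟩, ht, ⟨hs, hk⟩, rfl⟩
    rcases l with _ | ⟨st, l⟩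
    · exact ⟨rfl, κ, j, hσ, ((h D D κ ⟨rfl, hP⟩).2 _ ht).2, hj⟩
    by_cases hD : r ∈ D
    · exact vacuous hD
    · refine (((h D D κ ⟨rfl, hP⟩).2 _ ht).hide hΓ hk (init κ j σ hσ hj hD _ hs)).mono ?_
      rintro D' σ' ⟨D'', κ', s'', ⟨x, hx, hxJ, hxF, hxD, -, hrD, hDD⟩, rfl, hQ⟩
      have hxC : x ≠ .code := fun hx => hD (hxD.2 hx)
      refine ⟨?_, ?_⟩
      · ext r'
        by_cases hr : r' = r
        · subst hr; exact iff_of_false hrD hD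
        · exact (hDD r' hr).symm
      · cases x with
        | avail j' => exact ⟨κ', j', hx, hQ, hxJ j' rfl⟩
        | code => exact absurd rfl hxC
        | frame => exact absurd rfl hxF

/-- While the Code holds `r`, its moves in a context without `r` are also moves in a context that
declares an invariant for `r`. -/
theorem Safe.update_ctx {r : Lock} {J : Assertion Var Perm} (hΓ : Γ r = none)
    {R : Set Lock → LState Var Perm → Prop} :
    ∀ {l : List (CodeStep Var Lock)} {D : Set Lock} {σ : LState Var Perm}, r ∈ D →
      Safe Γ R l D σ → Safe (Function.update Γ r (some J)) R l D σ
  | [], _, _, _, hs => hs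
  | st :: l, D, σ, hr, hs => by
    rintro z rfl rfl hpre hz
    obtain ⟨z', ⟨he, hc, hresp, hout, hperm⟩, hs'⟩ := hs z rfl rfl hpre fun r' σ' h J' hJ' => by
      have : r' ≠ r := by rintro rfl; simp [hΓ] at hJ'
      exact hz r' σ' h J' (by rwa [Function.update_of_ne this])
    have hr' : z'.res r = .code := (hout r hΓ).trans hr
    refine ⟨z', ⟨he, hc, fun r' σ' h J' hJ' => ?_, fun r' h => ?_, hperm⟩,
      Safe.update_ctx hΓ hr' hs'⟩
    · have : r' ≠ r := by rintro rfl; simp [hr'] at h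
      rw [Function.update_of_ne this] at hJ'
      exact hresp r' σ' h J' hJ'
    · have : r' ≠ r := by rintro rfl; simp at h
      exact hout r' (by rwa [Function.update_of_ne this] at h)

end Hiding

/-! ### The rules of the logic -/

section Rules

open Assertion

variable {Var : Type u} {Lock : Type v} {Perm : Type w} [PermMonoid Perm] [Fintype Lock]
  {Γ : Ctx Var Lock Perm} {P Q : Assertion Var Perm} {B : BExp Var} {D : Set Lock}

theorem sound_assign (x : Var) (E : AExp Var) (X : ℤ) :
    Sound Γ (Owning (own PermMonoid.top x ⊓ eq (.const X) E) D) (.ofInstr (.assign x E))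
      (Owning (own PermMonoid.top x ⊓ eq (.var x) (.const X)) D) := by
  refine sound_ofInstr ?_
  rintro ⟨s, m, s', hs⟩ z rfl ⟨hD, ⟨k, hk⟩, n, hn, hE⟩ hpre hz
  cases hn
  have hE' := SState.combine_eval hpre hE
  have hret : Returns s (.assign x E) s' := hs.resolve_right fun h => by
    cases h with | assign h => simp [hE'] at h
  obtain ⟨z', ha, hD', hc⟩ := exists_answer_put (n := X) hpre hz rfl rfl hk hret (by
    cases hret with | assign h => rw [hE'] at h; cases h; rfl)
  have hx : z'.code (Sum.inl x) = some (X, PermMonoid.top) := by rw [hc, FinPMap.put_self]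
  exact ⟨z', ha, hD'.trans hD, ⟨X, hx⟩, X, by simp [AExp.eval, LState.forget_apply, hx], rfl⟩

theorem sound_store (E E' : AExp Var) :
    Sound Γ (Owning ((fun σ => ∃ n, pointsTo E PermMonoid.top (.const n) σ) ⊓ definedExp E') D)
      (.ofInstr (.store E E')) (Owning (pointsTo E PermMonoid.top E') D) := by
  refine sound_ofInstr ?_
  rintro ⟨s, m, s', hs⟩ z rfl ⟨hD, ⟨k, l, k', hE, hk', hl, hheap⟩, hdef⟩ hpre hz
  obtain ⟨n, hn⟩ := AExp.exists_eval (μ := z.code.forget) E' fun x hx => by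
    simpa [LState.forget_apply] using hdef x hx
  have hE₁ := SState.combine_eval hpre hE
  have hn₁ := SState.combine_eval hpre hn
  have hl₁ := SState.combine_cell hpre hl
  have hret : Returns s (.store E E') s' := hs.resolve_right fun h => by
    cases h with
    | store_addr h => exact h ⟨l, hE₁, by simp [hl₁]⟩
    | store_val h => simp [hn₁] at h
  obtain ⟨z', ha, hD', hc⟩ := exists_answer_put (n := n) (a := Sum.inr l) hpre hz rfl rfl hl hret
    (by
      cases hret with
      | store h h' =>
        have e := h.1
        rw [hE₁] at e
        rw [hn₁] at h'
        cases h'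
        rw [Int.ofNat_inj.1 (Option.some.inj e)])
  -- The stack is the same before and after.
  have hstack : ∀ F : AExp Var, F.eval z'.code.forget = F.eval z.code.forget := fun F =>
    F.eval_congr fun y => by
      rw [hc, LState.forget_apply, LState.forget_apply, FinPMap.put_of_ne _ _ (by simp)]
  refine ⟨z', ha, hD'.trans hD, l, n, (hstack E).trans hE, (hstack E').trans hn, ?_, ?_⟩
  · rw [hc, FinPMap.put_self]
  · intro l' hl'
    rw [hc, FinPMap.put_of_ne _ _ (by simpa using hl')]
    exact hheap l' hl'

theorem sound_load (x : Var) (E : AExp Var) (p : Perm) (n : ℤ) :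
    Sound Γ (Owning (sep (pointsTo E p (.const n)) (own PermMonoid.top x)) D)
      (.ofInstr (.load x E)) (Owning (sep (pointsTo E p (.const n))
        (own PermMonoid.top x ⊓ eq (.var x) (.const n))) D) := by
  refine sound_ofInstr ?_
  rintro ⟨s, m, s', hs⟩ z rfl ⟨hD, σ₁, σ₂, hσ, hp, k, hk⟩ hpre hz
  have hp' := hp
  obtain ⟨l, _, hE, hn, hl, -⟩ := hp'
  cases hn
  rw [LState.star_comm] at hσ
  have hσ' := hσ
  rw [LState.star_comm] at hσ'
  have hxz := (LState.star_top_right hσ hk).2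
  have hE₁ := SState.combine_eval hpre
    (E.eval_mono (LState.star_forget_mono hσ') hE)
  obtain ⟨q, hq⟩ := LState.star_apply_some hσ' hl
  have hl₁ := SState.combine_cell hpre hq
  have hret : Returns s (.load x E) s' := hs.resolve_right fun h => by
    cases h with | load h => exact h ⟨l, hE₁, by simp [hl₁]⟩
  obtain ⟨z', ha, hD', hc⟩ := exists_answer_put (n := n) hpre hz rfl rfl hxz hret (by
    cases hret with
    | load h h' =>
      rw [hE₁] at h
      rw [← Int.ofNat_inj.1 (Option.some.inj h), hl₁] at h'
      cases h'
      rfl)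
  have hstar := LState.star_put hσ hk n
  rw [LState.star_comm, ← hc] at hstar
  refine ⟨z', ha, hD'.trans hD, σ₁, _, hstar, hp, ⟨n, FinPMap.put_self _ _ _⟩, n, ?_, rfl⟩
  simp [AExp.eval, LState.forget_apply, FinPMap.put_self]

/-- The evaluation of an expression whose variables the Code owns does not abort. -/
theorem sound_whenAbort {R : Set Lock → LState Var Perm → Prop} (hB : P ≤ defined B) :
    Sound Γ (Owning P D) (.whenAbort B) R := by
  refine sound_generate ?_ fun _ _ _ _ ht => ht.elim
  rintro D' σ ⟨-, hP⟩ t ⟨st, -, -, e, habort, -⟩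
  rw [e]
  refine safe_singleton ?_
  rintro z rfl - hpre -
  obtain ⟨b, hb⟩ := BExp.exists_eval (μ := z.code.forget) B fun x hx => by
    simpa [LState.forget_apply] using hB _ hP x hx
  rw [SState.combine_evalB hpre (hB _ hP), hb] at habort
  cases habort

theorem sound_nop_when (hB : P ≤ defined B) {b : Bool} :
    Sound Γ (Owning P D) ((TransSys.ofInstr .nop).when B b)
      (Owning (P ⊓ fun σ => B.eval σ.forget = some b) D) := by
  refine sound_ofInstr_when ?_
  rintro st z hm hb ⟨hD, hP⟩ hpre hz
  rw [SState.combine_evalB hpre (hB _ hP)] at hb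
  exact ⟨z, answer_nop hpre hz hm, hD, hP, hb⟩

theorem Sound.ite {T T' : TransSys Var Lock} (hB : P ≤ defined B)
    (h : Sound Γ (Owning (P ⊓ holds B) D) T (Owning Q D))
    (h' : Sound Γ (Owning (P ⊓ (holds B)ᶜ) D) T' (Owning Q D)) :
    Sound Γ (Owning P D) (((((TransSys.ofInstr .nop).when B true).seq T).union
      (((TransSys.ofInstr .nop).when B false).seq T')).union (.whenAbort B)) (Owning Q D) := by
  refine (((sound_nop_when hB).seq h).union ((sound_nop_when hB).seq ?_)).union
    (sound_whenAbort hB)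
  refine h'.mono ?_ fun _ _ h => h
  rintro D' σ ⟨hD, hP, hb⟩
  refine ⟨hD, hP, fun hb' => ?_⟩
  rw [holds, hb] at hb'
  cases hb'

theorem Sound.and {Q' P' : Assertion Var Perm} [DecidableEq Lock] {T : TransSys Var Lock}
    (hΓ : Γ.Precise) (h : Sound Γ (Owning P D) T (Owning Q D))
    (h' : Sound Γ (Owning P' D) T (Owning Q' D)) :
    Sound Γ (Owning (P ⊓ P') D) T (Owning (Q ⊓ Q') D) := by
  rintro D' σ ⟨hD, hP, hP'⟩
  refine ⟨(h D' σ ⟨hD, hP⟩).1, fun t ht => ?_⟩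
  exact (((h D' σ ⟨hD, hP⟩).2 t ht).and hΓ ((h' D' σ ⟨hD, hP'⟩).2 t ht)).mono
    fun _ _ hr => ⟨hr.1.1, hr.1.2, hr.2.2⟩

theorem Sound.par {P₁ P₂ Q₁ Q₂ : Assertion Var Perm} {T₁ T₂ : TransSys Var Lock}
    (h₁ : ∀ D, Sound Γ (Owning P₁ D) T₁ (Owning Q₁ D))
    (h₂ : ∀ D, Sound Γ (Owning P₂ D) T₂ (Owning Q₂ D)) :
    Sound Γ (Owning (P₁.sep P₂) D) (T₁.par T₂) (Owning (Q₁.sep Q₂) D) := by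
  -- The locks that the Code owns at the start may be given to either component.
  refine sound_generate ?_ ?_
  · rintro D σ ⟨rfl, σ₁, σ₂, hσ, hP₁, hP₂⟩ t ⟨t₁, ht₁, t₂, ht₂, -, -, -, -, hsh⟩
    exact (Safe.par hsh (Set.union_empty _).symm (Set.disjoint_empty _) hσ
      ((h₁ D D σ₁ ⟨rfl, hP₁⟩).1 t₁ ht₁) ((h₂ ∅ ∅ σ₂ ⟨rfl, hP₂⟩).1 t₂ ht₂)).mono
      fun _ _ _ => trivial
  · rintro D σ ⟨rfl, σ₁, σ₂, hσ, hP₁, hP₂⟩ t ⟨t₁, ht₁, t₂, ht₂, -, -, -, -, hsh⟩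
    refine (Safe.par hsh (Set.union_empty _).symm (Set.disjoint_empty _) hσ
      ((h₁ D D σ₁ ⟨rfl, hP₁⟩).2 t₁ ht₁) ((h₂ ∅ ∅ σ₂ ⟨rfl, hP₂⟩).2 t₂ ht₂)).mono ?_
    rintro _ σ' ⟨_, _, σ₁', σ₂', rfl, hσ', ⟨rfl, hQ₁⟩, rfl, hQ₂⟩
    exact ⟨Set.union_empty _, σ₁', σ₂', hσ', hQ₁, hQ₂⟩

/-- A framed assertion belongs to a second thread that does nothing. -/
theorem Sound.frame {F : Assertion Var Perm} {T : TransSys Var Lock}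
    (h : Sound Γ (Owning P D) T (Owning Q D)) :
    Sound Γ (Owning (P.sep F) D) T (Owning (Q.sep F) D) := by
  rintro D σ ⟨rfl, σ₁, σ₂, hσ, hP, hF⟩
  have key : ∀ {R : Set Lock → LState Var Perm → Prop} {l : List (CodeStep Var Lock)},
      Safe Γ R l D σ₁ → Safe Γ (fun D σ => ∃ D₁ D₂ σ₁ σ₂, D = D₁ ∪ D₂ ∧ σ₁.star σ₂ = some σ ∧
        R D₁ σ₁ ∧ Owning F ∅ D₂ σ₂) l D σ := fun hs =>
    Safe.par (Shuffle.nil_right _) (Set.union_empty _).symm (Set.disjoint_empty _) hσ hs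
      ⟨rfl, hF⟩
  refine ⟨fun t ht => (key ((h D σ₁ ⟨rfl, hP⟩).1 t ht)).mono fun _ _ _ => trivial,
    fun t ht => (key ((h D σ₁ ⟨rfl, hP⟩).2 t ht)).mono ?_⟩
  rintro _ σ' ⟨_, _, σ₁', σ₂', rfl, hσ', ⟨rfl, hQ⟩, rfl, hF⟩
  exact ⟨Set.union_empty _, σ₁', σ₂', hσ', hQ, hF⟩

variable [DecidableEq Lock]

theorem Sound.withWhen {r : Lock} {J : Assertion Var Perm} {T : TransSys Var Lock}
    (hΓ : Γ r = none) (hB : P ≤ defined B)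
    (h : ∀ D, Sound Γ (Owning (P.sep J ⊓ holds B) D) T (Owning (Q.sep J) D)) :
    Sound (Function.update Γ r (some J)) (Owning P D)
      (((T.inside r).when B true).union (.whenAbort B)) (Owning Q D) := by
  have hJ : Function.update Γ r (some J) r = some J := Function.update_self _ _ _
  let R₁ : Set Lock → LState Var Perm → Prop :=
    fun D' σ => r ∉ D ∧ Owning (P.sep J ⊓ holds B) (insert r D) D' σ
  let R₂ : Set Lock → LState Var Perm → Prop :=
    fun D' σ => r ∉ D ∧ Owning (Q.sep J) (insert r D) D' σ
  have hacq : Sound (Function.update Γ r (some J)) (Owning P D)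
      ((TransSys.ofInstr (.acquire r)).when B true) R₁ := by
    refine sound_ofInstr_when ?_
    rintro st z hm hb ⟨rfl, hP⟩ hpre hz
    obtain ⟨z', j, ha, hj, hstar, hr, hD⟩ := exists_answer_acquire hpre hz hm hJ
    rw [SState.combine_evalB hpre (hB _ hP)] at hb
    exact ⟨z', ha, hr, hD, ⟨z.code, j, hstar, hP, hj⟩,
      B.eval_mono (LState.star_forget_mono hstar) hb⟩
  have hbody : Sound (Function.update Γ r (some J)) R₁ T R₂ := by
    rintro _ σ ⟨hr, rfl, hP⟩
    refine ⟨fun t ht => ((h _ _ σ ⟨rfl, hP⟩).1 t ht).update_ctx hΓ (Set.mem_insert _ _),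
      fun t ht => (((h _ _ σ ⟨rfl, hP⟩).2 t ht).update_ctx hΓ (Set.mem_insert _ _)).mono
        fun _ _ hq => ⟨hr, hq⟩⟩
  have hrel : Sound (Function.update Γ r (some J)) R₂ (TransSys.ofInstr (.release r))
      (Owning Q D) := by
    refine sound_ofInstr ?_
    rintro st z hm ⟨hr, hD, q, j, hstar, hq, hj⟩ hpre hz
    obtain ⟨z', ha, hc, hD'⟩ := exists_answer_release hpre hz hm hJ
      (hD ▸ Set.mem_insert r D) hstar hj
    refine ⟨z', ha, ?_, hc ▸ hq⟩
    rw [hD', hD, Set.insert_sdiff_of_mem _ (Set.mem_singleton r),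
      Set.sdiff_singleton_eq_self hr]
  have hacq_ne : ∀ t ∈ (TransSys.ofInstr (Instr.acquire r : Instr Var Lock)).ret,
      t.steps ≠ [] := by
    rintro t ⟨st, e, -⟩
    simp [e]
  refine Sound.union (Sound.when_seq ?_ ((Sound.when_seq hacq_ne (hacq.seq hbody)).seq hrel))
    (sound_whenAbort hB)
  rintro t ⟨t₁, ht₁, t₂, ht₂, -, rfl⟩
  simp [Trace.comp, hacq_ne t₁ ht₁]

/-- The traces of a derivable command are safe. -/
theorem Derivation.sound {C : Cmd Var Lock} (d : Derivation Γ P C Q) :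
    ∀ D, Sound Γ (Owning P D) C.sem (Owning Q D) := by
  induction d with
  | aff x E X => exact fun D => sound_assign x E X
  | store E E' => exact fun D => sound_store E E'
  | load x E p n _ => exact fun D => sound_load x E p n
  | seq _ _ ih ih' => exact fun D => (ih D).seq (ih' D)
  | ite hB _ _ ih ih' => exact fun D => (ih D).ite hB (ih' D)
  | conj hΓ _ _ ih ih' => exact fun D => (ih D).and hΓ (ih' D)
  | res hΓ _ ih => exact fun D => Sound.hide hΓ ih D
  | withWhen hΓ hB _ ih => exact fun D => Sound.withWhen hΓ hB ih
  | par _ _ ih ih' => exact fun D => Sound.par ih ih'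
  | frame _ ih => exact fun D => (ih D).frame
  | conseq hP _ hQ ih =>
    exact fun D => (ih D).mono (fun _ _ h => ⟨h.1, hP _ h.2⟩) fun _ _ h => ⟨h.1, hQ _ h.2⟩

end Rules

/-! ### Paths and plays -/

namespace Path

variable {V : Type w} {W : Type u} {Lab : Type v} {edge : V → Lab → V → Prop}

/-- The last vertex of a path. -/
def last (π : Path V Lab) : V := (π.moves.getLast?.map Prod.snd).getD π.start

theorem last_snoc (π : Path V Lab) (a : Lab) (x : V) : (π.snoc a x).last = x := by
  simp [last, snoc]

theorem length_snoc (π : Path V Lab) (a : Lab) (x : V) :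
    (π.snoc a x).moves.length = π.moves.length + 1 := by simp [snoc]

theorem vertices_snoc (π : Path V Lab) (a : Lab) (x : V) :
    (π.snoc a x).vertices = π.vertices ++ [x] := by simp [vertices, snoc]

theorem map_snoc (f : V → W) (π : Path V Lab) (a : Lab) (x : V) :
    (π.snoc a x).map f = (π.map f).snoc a (f x) := by simp [map, snoc]

theorem Initial.trans {π₁ π₂ π₃ : Path V Lab} (h : π₁.Initial π₂) (h' : π₂.Initial π₃) :
    π₁.Initial π₃ := ⟨h.1.trans h'.1, h.2.trans h'.2⟩

theorem Initial.map (f : V → W) {π π' : Path V Lab} (h : π.Initial π') :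
    (π.map f).Initial (π'.map f) := ⟨congrArg f h.1, h.2.map _⟩

theorem initial_snoc_iff {π π' : Path V Lab} {a : Lab} {x : V} :
    π'.Initial (π.snoc a x) ↔ π' = π.snoc a x ∨ π'.Initial π := by
  simp only [Initial, snoc, List.prefix_concat_iff, Path.ext_iff]
  tauto

theorem walk_append {l l' : List (Lab × V)} :
    ∀ {x : V}, Walk edge x (l ++ l') ↔
      Walk edge x l ∧ Walk edge ((l.getLast?.map Prod.snd).getD x) l' := by
  induction l with
  | nil => simp [Walk]
  | cons e l ih =>
    intro x
    obtain ⟨a, y⟩ := e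
    rw [List.cons_append, Walk, Walk, ih, and_assoc, List.getLast?_cons]
    cases l.getLast? <;> rfl

theorem isIn_snoc {π : Path V Lab} {a : Lab} {x : V} :
    (π.snoc a x).IsIn edge ↔ π.IsIn edge ∧ edge π.last a x := by
  simp [IsIn, snoc, walk_append, Walk, last]

theorem IsIn.of_initial {π π' : Path V Lab} (h : π'.Initial π) (hπ : π.IsIn edge) :
    π'.IsIn edge := by
  obtain ⟨hs, r, hr⟩ := h
  rw [IsIn, ← hr, walk_append, ← hs] at hπ
  exact hπ.1

/-- An initial segment can be extended by the transition that follows it. -/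
theorem Initial.snoc {π π' : Path V Lab} {a : Lab} {x : V} (h : π.Initial π')
    (hx : π'.moves[π.moves.length]? = some (a, x)) : (π.snoc a x).Initial π' := by
  obtain ⟨hs, r, hr⟩ := h
  refine ⟨hs, ?_⟩
  rw [← hr, List.getElem?_append_right le_rfl, Nat.sub_self] at hx
  obtain ⟨r, rfl⟩ : ∃ r', r = (a, x) :: r' := by
    cases r with
    | nil => simp at hx
    | cons b r => exact ⟨r, by simpa using hx⟩
  exact ⟨r, by simp [Path.snoc, ← hr]⟩

theorem Initial.getElem?_of_snoc {π π' : Path V Lab} {a : Lab} {x : V}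
    (h : (π.snoc a x).Initial π') : π'.moves[π.moves.length]? = some (a, x) := by
  obtain ⟨-, r, hr⟩ := h
  simp [← hr, Path.snoc]

end Path

section TracePaths

variable {Var : Type u} {Lock : Type v}

theorem Trace.path_moves_even (t : Trace Var Lock) {k : ℕ} (hk : k ≤ t.length) :
    t.path.moves[2 * k]? = some (.env, nextState (t.steps.drop k) t.target) := by
  obtain ⟨s, l, s'⟩ := t
  simp only [Trace.path, Trace.length] at hk ⊢
  induction l generalizing k with
  | nil =>
    obtain rfl : k = 0 := by simpa using hk
    simp [nextState]
  | cons st l ih =>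
    cases k with
    | zero => simp [nextState]
    | succ k =>
      rw [show 2 * (k + 1) = 2 * k + 1 + 1 by ring]
      simpa using ih (by simpa using hk)

theorem Trace.path_moves_odd (t : Trace Var Lock) (k : ℕ) :
    t.path.moves[2 * k + 1]? = t.steps[k]?.map fun st => (.instr st.instr, st.post) := by
  obtain ⟨s, l, s'⟩ := t
  simp only [Trace.path]
  induction l generalizing k with
  | nil => simp
  | cons st l ih =>
    cases k with
    | zero => simp
    | succ k =>
      rw [show 2 * (k + 1) + 1 = 2 * k + 1 + 1 + 1 by ring]
      simpa using ih k

theorem Trace.path_moves_length (t : Trace Var Lock) :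
    t.path.moves.length = 2 * t.length + 1 := by
  simp [Trace.path, Trace.length, List.length_flatMap, mul_comm]

end TracePaths

/-! ### Winning strategies -/

section Strategies

variable {Var : Type u} {Lock : Type v} {Perm : Type w} [PermMonoid Perm] [Fintype Lock]
  {Γ : Ctx Var Lock Perm} {P Q : Assertion Var Perm} {C : Cmd Var Lock} {t : Trace Var Lock}
  {π π' : Path (SState Var Lock Perm) (Label Var Lock)}

theorem mem_SGame_of_initial (h : π'.Initial π) (hπ : π ∈ SGame Perm t) : π' ∈ SGame Perm t :=
  ⟨Path.IsIn.of_initial h hπ.1, (h.map _).trans hπ.2⟩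

theorem mem_SGame_snoc {a : Label Var Lock} {z : SState Var Lock Perm} (hπ : π ∈ SGame Perm t)
    (hz : π.last.Edge a z) (hm : t.path.moves[π.moves.length]? = some (a, z.combine)) :
    π.snoc a z ∈ SGame Perm t := by
  refine ⟨Path.isIn_snoc.2 ⟨hπ.1, hz⟩, ?_⟩
  rw [Path.map_snoc]
  exact hπ.2.snoc (by simpa [Path.map] using hm)

theorem WinningPlay.of_initial (h : π'.Initial π) (hπ : WinningPlay Γ P C Q t π) :
    WinningPlay Γ P C Q t π' := by
  intro i z hz
  obtain ⟨hs, r, hr⟩ := h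
  have hv : π.vertices = π'.vertices ++ r.map Prod.snd := by simp [Path.vertices, hs, ← hr]
  refine hπ i z ?_
  have hi : i < π'.vertices.length := (List.getElem?_eq_some_iff.1 hz).1
  rw [hv, List.getElem?_append_left hi]
  exact hz

theorem winningPlay_snoc {a : Label Var Lock} {z : SState Var Lock Perm} :
    WinningPlay Γ P C Q t (π.snoc a z) ↔
      WinningPlay Γ P C Q t π ∧ SPred.Sat z (winPred Γ P C Q t (π.moves.length + 2)) := by
  have hlen : π.vertices.length = π.moves.length + 1 := by simp [Path.vertices]
  refine ⟨fun h => ⟨h.of_initial (Path.initial_snoc_iff.2 (Or.inr ⟨rfl, List.prefix_rfl⟩)),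
    h (π.moves.length + 1) z ?_⟩, fun ⟨h, hz⟩ i z' hz' => ?_⟩
  · rw [Path.vertices_snoc, ← hlen, List.getElem?_concat_length]
    rfl
  · rw [Path.vertices_snoc] at hz'
    rcases lt_or_ge i π.vertices.length with hi | hi
    · rw [List.getElem?_append_left hi] at hz'
      exact h i z' hz'
    · rw [List.getElem?_append_right hi] at hz'
      rcases hn : i - π.vertices.length with _ | n <;> rw [hn] at hz'
      · obtain rfl : i = π.moves.length + 1 := by omega
        cases hz'
        exact hz
      · cases hz'

/-- What the Code must have reached at the end of `t`: the postcondition, if `t` returns. -/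
def Reached (C : Cmd Var Lock) (Q : Assertion Var Perm) (t : Trace Var Lock) (_ : Set Lock)
    (σ : LState Var Perm) : Prop := t ∈ C.sem.ret → Q σ

/-- The strategy that consists of the winning plays such that, each time it is Adam's turn, the Code
is safe along the rest of the trace. -/
def safeStrategy (Γ : Ctx Var Lock Perm) (P : Assertion Var Perm) (C : Cmd Var Lock)
    (Q : Assertion Var Perm) (t : Trace Var Lock) :
    Set (Path (SState Var Lock Perm) (Label Var Lock)) :=
  {π | π ∈ SGame Perm t ∧ WinningPlay Γ P C Q t π ∧
    ∀ π' : Path (SState Var Lock Perm) (Label Var Lock), π'.Initial π →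
      ∀ k, π'.moves.length = 2 * k →
        Safe Γ (Reached C Q t) (t.steps.drop k) π'.last.domC π'.last.code}

theorem safeStrategy_isWinning
    (h : ∀ (D : Set Lock) (σ : LState Var Perm), P σ → Safe Γ (Reached C Q t) t.steps D σ) :
    IsWinningStrategy Γ P C Q t (safeStrategy Γ P C Q t) where
  plays _ hπ := hπ.1
  closed π hπ π' hi := ⟨mem_SGame_of_initial hi hπ.1, hπ.2.1.of_initial hi,
    fun π'' hi' => hπ.2.2 π'' (hi'.trans hi)⟩
  winning _ hπ := hπ.2.1
  start z hz hw := by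
    refine ⟨hz, hw, ?_⟩
    rintro ⟨_, m⟩ ⟨rfl, hm⟩ k hk
    obtain rfl : m = [] := List.prefix_nil.1 hm
    obtain rfl : k = 0 := by simpa using hk.symm
    exact h _ _ ((hw 0 _ rfl).1.1 rfl)
  answer π hπ z₁ hg hw := by
    have hedge : π.last.Edge .env z₁ := (Path.isIn_snoc.1 hg.1).2
    have hcomb : t.path.moves[π.moves.length]? = some (.env, z₁.combine) := by
      have := hg.2
      rw [Path.map_snoc] at this
      simpa [Path.map] using this.getElem?_of_snoc
    -- It is Adam's turn only after an even number of transitions.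
    obtain ⟨k, hk⟩ : ∃ k, π.moves.length = 2 * k := by
      rcases Nat.even_or_odd' π.moves.length with ⟨k, hk | hk⟩
      · exact ⟨k, hk⟩
      · rw [hk, Trace.path_moves_odd, Option.map_eq_some_iff] at hcomb
        obtain ⟨st, -, e⟩ := hcomb
        cases e
    have hmem : π.snoc .env z₁ ∈ safeStrategy Γ P C Q t := by
      refine ⟨hg, hw, fun π' hi k' hk' => ?_⟩
      rcases Path.initial_snoc_iff.1 hi with rfl | hi
      · rw [Path.length_snoc] at hk'
        omega
      · exact hπ.2.2 π' hi k' hk'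
    refine ⟨hmem, fun hlt => ?_⟩
    rw [Trace.path_moves_length, hk, Trace.length] at hlt
    have hkp : k < t.steps.length := by omega
    rw [hk, Trace.path_moves_even t hkp.le,
      List.drop_eq_getElem_cons hkp] at hcomb
    have hpre : z₁.combine = t.steps[k].pre := by
      simp only [nextState, Option.some.injEq, Prod.mk.injEq, true_and] at hcomb
      exact hcomb.symm
    have hsafe := hπ.2.2 π ⟨rfl, List.prefix_rfl⟩ k hk
    rw [List.drop_eq_getElem_cons hkp] at hsafe
    obtain ⟨z₂, ha, hs⟩ := hsafe z₁ hedge.1 hedge.2 hpre (winningPlay_snoc.1 hw).2.2.2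
    have hlen : (π.snoc .env z₁).moves.length = 2 * k + 1 := by rw [Path.length_snoc, hk]
    refine ⟨t.steps[k].instr, z₂, mem_SGame_snoc hg ?_ ?_, winningPlay_snoc.2
      ⟨hw, ⟨?_, ?_⟩, trivial, ha.respects⟩, ?_⟩
    · rw [Path.last_snoc]; exact ha.edge
    · rw [hlen, Trace.path_moves_odd, List.getElem?_eq_getElem hkp, ha.combine_eq]
      rfl
    · intro h1
      omega
    · -- The states number `2p+1` and `2p+2` come after the last Code transition.
      intro hret hle
      rw [hlen, Trace.length] at hle
      rw [List.drop_eq_nil_of_le (by omega)] at hs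
      exact hs hret
    · intro π' hi k' hk'
      rcases Path.initial_snoc_iff.1 hi with rfl | hi
      · rw [Path.length_snoc, hlen] at hk'
        obtain rfl : k' = k + 1 := by omega
        rw [Path.last_snoc]
        exact hs
      · exact hmem.2.2 π' hi k' hk'

end Strategies

end CSL

theorem theorem1 {Var : Type*} {Lock : Type*} {Perm : Type*} [Fintype Lock]
    [DecidableEq Lock] [CSL.PermMonoid Perm]
    (Γ : CSL.Ctx Var Lock Perm) (P Q : CSL.Assertion Var Perm) (C : CSL.Cmd Var Lock)
    (π : CSL.Derivation Γ P C Q) (t : CSL.Trace Var Lock) (ht : t ∈ C.sem.traces) :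
    ∃ strat : Set (CSL.Path (CSL.SState Var Lock Perm) (CSL.Label Var Lock)),
      CSL.IsWinningStrategy Γ P C Q t strat := by
  refine ⟨_, CSL.safeStrategy_isWinning fun D σ hP => ?_⟩
  have h := π.sound D D σ ⟨rfl, hP⟩
  by_cases hret : t ∈ C.sem.ret
  · exact (h.2 t hret).mono fun _ _ hQ _ => hQ.2
  · exact (h.1 t ht).mono fun _ _ _ hret' => absurd hret' hret
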